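/- Let $p=(p_x)_{x\in\mathbb N}$, $\mathbb N=\{0,1,2,\dots\}$, be a decreasing (that is, $p_x\ge p_{x+1}$) probability mass function with $\kappa=\sup\{x:p_x>0\}<\infty$, and let $X_1,X_2,\dots$ be i.i.d. with mass function $p$. *Estimators.* Let $\widehat p_{n,x}=n^{-1}\#\{i\le n: X_i=x\}$. For a finite vector $w=(w_0,\dots,w_m)$ let $\mathrm{rear}(w)$ be its entries in decreasing order and let $\mathrm{gren}(w)$ be the vector of the $m+1$ slopes, over the intervals $[x-1,x]$, $x=0,\dots,m$, of the least concave majorant of the points $\bigl(j,\sum_{i=0}^{j}w_i\bigr)$, $j=-1,0,\dots,m$. Put $\widehat p_n^R=\mathrm{rear}(\widehat p_n)$ and $\widehat p^G_n=\mathrm{gren}(\widehat p_n)$, where $\widehat p_n$ is regarded as a vector on $\{0,\dots,\max_{i\le n}X_i\}$ and the results are extended by $0$. Let $q_x=-(x+1)(p_{x+1}-p_x)$ be the mixing distribution of $p$; let $\widehat q_n,\widehat q_n^R,\widehat q_n^G$ be obtained by the same formula from $\widehat p_n,\widehat p_n^R,\widehat p_n^G$; and let $Z_n=\sqrt n(\widehat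 q_n-q)$, $Z_n^R=\sqrt n(\widehat q_n^R-q)$, $Z_n^G=\sqrt n(\widehat q_n^G-q)$. *Limits.* Let $Y=(Y_x)_{x\in\mathbb N}$ be a centred Gaussian process with $\mathrm{Cov}(Y_x,Y_{x'})=p_x\delta_{x,x'}-p_xp_{x'}$. Let $Y^R$ (resp. $Y^G$) be obtained from $Y$ by applying $\mathrm{rear}$ (resp. $\mathrm{gren}$) separately to $(Y_r,\dots,Y_s)$ for every maximal interval $\{r,\dots,s\}\subseteq\{0,\dots,\kappa\}$ on which $p$ is constant. Put $Z_x=-(x+1)(Y_{x+1}-Y_x)$, $Z^R_x=-(x+1)(Y^R_{x+1}-Y^R_x)$, $Z^G_x=-(x+1)(Y^G_{x+1}-Y^G_x)$. Then, as $n\to\infty$: 1. $Z_n\Rightarrow Z$, $Z_n^R\Rightarrow Z^R$ and $Z_n^G\Rightarrow Z^G$ weakly in $\ell_k$, for every $1\le k\le\infty$. 2. For every $1\le k\le\infty$, $\|Z_n\|_k\to_d\|Z\|_k$, $\|Z_n^R\|_k\to_d\|Z^R\|_k$ and $\|Z_n^G\|_k\to_d\|Z^G\|_k$, and these convergences also hold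 in expectation; for $k<\infty$ the same is true of the $k$-th powers of these norms. 3. Let $H^2(a,b)=\frac12\sum_{x\ge0}|\sqrt{a_x}-\sqrt{b_x}|^2$, where $\sqrt t=i\sqrt{|t|}$ for $t<0$ (this occurs only for $\widehat q_n$, whose entries may be negative). Then, as $[0,\infty]$-valued random variables, $$nH^2(\widehat q_n,q)\to_d\frac18\sum_{x=0}^{\kappa}\frac{Z_x^2}{q_x},\qquad nH^2(\widehat q_n^R,q)\to_d\frac18\sum_{x=0}^{\kappa}\frac{(Z_x^R)^2}{q_x},\qquad nH^2(\widehat q_n^G,q)\to_d\frac18\sum_{x=0}^{\kappa}\frac{(Z_x^G)^2}{q_x},$$ where $c/0=\infty$ for $c>0$ and $0/0=0$; and the expectations (in $[0,\infty]$) converge to the expectations of the limits. -/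

import Mathlib

open MeasureTheory ProbabilityTheory Filter Topology
open scoped ENNReal

noncomputable section

namespace DiscreteMonotone

/-! ### Monotone mass functions -/

/-- `p` is a decreasing (non-increasing) probability mass function on `ℕ`. -/
structure IsDecreasingPMF (p : ℕ → ℝ) : Prop where
  nonneg : ∀ x, 0 ≤ p x
  hasSum : HasSum p 1
  antitone : Antitone p

/-- `κ = sup {x : p_x > 0}`. -/
def supportEnd (p : ℕ → ℝ) : ℕ := sSup {x | 0 < p x}

/-- The sequence `-(x+1) Δ w_x = -(x+1) (w_{x+1} - w_x)`. For a mass function `w` this is its mixing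
distribution. -/
def mixing (w : ℕ → ℝ) : ℕ → ℝ := fun x => -((x : ℝ) + 1) * (w (x + 1) - w x)

/-! ### The operators `rear` and `gren`

Both act on the vector `(w 0, …, w (m - 1))`; the entries of the result outside `{0, …, m - 1}`
are set to `0`. -/

/-- The entries `w 0, …, w (m - 1)` listed in decreasing order. -/
def rear (m : ℕ) (w : ℕ → ℝ) : ℕ → ℝ := fun x =>
  if h : x < m then w (Tuple.sort (fun i : Fin m => -w i) ⟨x, h⟩) else 0

/-- The least concave majorant on `[0, m]` of the points `(j, w 0 + … + w (j - 1))`,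
`j = 0, …, m`, evaluated at `t`. (The abscissa is shifted by one, so that the partial sum up to and
including index `j` is attached to `j + 1` and the empty sum to `0`.) -/
def concaveMajorant (m : ℕ) (w : ℕ → ℝ) (t : ℝ) : ℝ :=
  sInf ((fun g : ℝ → ℝ => g t) ''
    {g | ConcaveOn ℝ (Set.Icc 0 (m : ℝ)) g ∧
      ∀ j : ℕ, j ≤ m → ∑ i ∈ Finset.range j, w i ≤ g j})

/-- The `m` slopes of the least concave majorant of the partial sums. -/
def gren (m : ℕ) (w : ℕ → ℝ) : ℕ → ℝ := fun x =>
  if x < m then concaveMajorant m w ((x : ℝ) + 1) - concaveMajorant m w (x : ℝ) else 0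

/-! ### The estimators -/

variable {Ω : Type*}

/-- Empirical mass function of `X_0, …, X_{n-1}`. -/
def empirical (X : ℕ → Ω → ℕ) (n : ℕ) (ω : Ω) : ℕ → ℝ := fun x =>
  (n : ℝ)⁻¹ * ∑ i ∈ Finset.range n, if X i ω = x then (1 : ℝ) else 0

/-- Length `max {X_0, …, X_{n-1}} + 1` of the vector of empirical frequencies. -/
def sampleLength (X : ℕ → Ω → ℕ) (n : ℕ) (ω : Ω) : ℕ :=
  (Finset.range n).sup (fun i => X i ω) + 1

/-- The rearrangement estimator. -/
def rearEstimator (X : ℕ → Ω → ℕ) (n : ℕ) (ω : Ω) : ℕ → ℝ :=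
  rear (sampleLength X n ω) (empirical X n ω)

/-- The Grenander estimator (the maximum likelihood estimator under monotonicity). -/
def grenEstimator (X : ℕ → Ω → ℕ) (n : ℕ) (ω : Ω) : ℕ → ℝ :=
  gren (sampleLength X n ω) (empirical X n ω)

/-- The process `√n (q̂_{n,x} - q_x)`, where `q̂_n` and `q` are the mixing distributions of the
estimator `phat n` and of `p`. -/
def mixingFluctuation (p : ℕ → ℝ) (phat : ℕ → Ω → ℕ → ℝ) (n : ℕ) (ω : Ω) : ℕ → ℝ := fun x =>
  √(n : ℝ) * (mixing (phat n ω) x - mixing p x)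

/-! ### The limit processes -/

/-- `Y` is a centred Gaussian process with covariances `p_x δ_{x,x'} - p_x p_{x'}`. -/
structure IsLimitGaussian [MeasurableSpace Ω] (p : ℕ → ℝ) (Y : ℕ → Ω → ℝ) (P : Measure Ω) :
    Prop where
  gaussian : IsGaussianProcess Y P
  mean : ∀ x, ∫ ω, Y x ω ∂P = 0
  cov : ∀ x x', covariance (Y x) (Y x') P = (if x = x' then p x else 0) - p x * p x'

/-- The operator `φ` applied to `y` separately on each interval of constancy
`{r, …, s} = {z : p_z = p_x}` of `p` inside the support of `p`; here `r` is the minimum of that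
interval and its length `s - r + 1` is its cardinality. Outside the support `y` is unchanged. -/
def blockwise (φ : ℕ → (ℕ → ℝ) → ℕ → ℝ) (p : ℕ → ℝ) (y : ℕ → ℝ) : ℕ → ℝ := fun x =>
  if 0 < p x then
    φ {z | p z = p x}.ncard (fun i => y (sInf {z | p z = p x} + i)) (x - sInf {z | p z = p x})
  else y x

/-- `Y^R`. -/
def limitRear (p : ℕ → ℝ) (Y : ℕ → Ω → ℝ) (ω : Ω) : ℕ → ℝ := blockwise rear p (fun x => Y x ω)

/-- `Y^G`. -/
def limitGren (p : ℕ → ℝ) (Y : ℕ → Ω → ℝ) (ω : Ω) : ℕ → ℝ := blockwise gren p (fun x => Y x ω)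

/-! ### The Hellinger statistics -/

/-- Squared Hellinger distance `½ ∑ |√a_x - √b_x|²` of two real sequences, as an element of
`[0, ∞]`. As entries of `a` may be negative, `√` is the principal complex square root. -/
def hellingerSq (a b : ℕ → ℝ) : ℝ≥0∞ :=
  2⁻¹ * ∑' x, ENNReal.ofReal (‖(a x : ℂ) ^ (1 / 2 : ℂ) - (b x : ℂ) ^ (1 / 2 : ℂ)‖ ^ 2)

/-- On non-negative sequences `hellingerSq` is given by the usual formula. -/
theorem hellingerSq_of_nonneg {a b : ℕ → ℝ} (ha : ∀ x, 0 ≤ a x) (hb : ∀ x, 0 ≤ b x) :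
    hellingerSq a b = 2⁻¹ * ∑' x, ENNReal.ofReal ((√(a x) - √(b x)) ^ 2) := by
  have key : ∀ t : ℝ, 0 ≤ t → (t : ℂ) ^ (1 / 2 : ℂ) = ((√t : ℝ) : ℂ) := by
    intro t ht
    rw [Real.sqrt_eq_rpow, Complex.ofReal_cpow ht]
    norm_num
  unfold hellingerSq
  congr 1
  refine tsum_congr fun x => ?_
  rw [key _ (ha x), key _ (hb x), ← Complex.ofReal_sub, Complex.norm_real, Real.norm_eq_abs,
    sq_abs]

/-- `⅛ ∑_{x=0}^κ z_x² / q_x` in `[0, ∞]`, where `q` is the mixing distribution of `p`, with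
`c / 0 = ∞` for `c > 0` and `0 / 0 = 0`. -/
def weightedSq (p z : ℕ → ℝ) : ℝ≥0∞ :=
  8⁻¹ * ∑ x ∈ Finset.range (supportEnd p + 1),
    ENNReal.ofReal (z x ^ 2) / ENNReal.ofReal (mixing p x)

/-! ### Modes of convergence -/

/-- The sequence space `ℓ_k`, `1 ≤ k ≤ ∞`. -/
abbrev Ell (k : ℝ≥0∞) : Type := lp (fun _ : ℕ => ℝ) k

/-- The Borel σ-algebra of `ℓ_k`. -/
instance ellMeasurableSpace (k : ℝ≥0∞) [Fact (1 ≤ k)] : MeasurableSpace (Ell k) := borel _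

instance ellBorelSpace (k : ℝ≥0∞) [Fact (1 ≤ k)] : BorelSpace (Ell k) := ⟨rfl⟩

open Classical in
/-- A sequence as an element of `ℓ_k` (`0` if it does not belong to `ℓ_k`). -/
def toEll (k : ℝ≥0∞) (w : ℕ → ℝ) : Ell k :=
  if h : Memℓp w k then ⟨w, h⟩ else 0

variable {Ω' : Type*} [MeasurableSpace Ω] [MeasurableSpace Ω']

/-- The processes `W n` and `W'` have almost all paths in `ℓ_k`, and `W n` converges weakly to `W'`
in `ℓ_k`. -/
def WeaklyConvergesInEll (k : ℝ≥0∞) [Fact (1 ≤ k)] (W : ℕ → Ω → ℕ → ℝ) (W' : Ω' → ℕ → ℝ)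
    (P : Measure Ω) [IsProbabilityMeasure P] (P' : Measure Ω') [IsProbabilityMeasure P'] : Prop :=
  (∀ n, ∀ᵐ ω ∂P, Memℓp (W n ω) k) ∧ (∀ᵐ ω ∂P', Memℓp (W' ω) k) ∧
    TendstoInDistribution (fun n ω => toEll k (W n ω)) atTop (fun ω => toEll k (W' ω))
      (fun _ => P) P'

/-- Convergence in distribution of real random variables, together with integrability and
convergence of their expectations. -/
def ConvergesInLawAndMean (T : ℕ → Ω → ℝ) (T' : Ω' → ℝ)
    (P : Measure Ω) [IsProbabilityMeasure P] (P' : Measure Ω') [IsProbabilityMeasure P'] : Prop :=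
  TendstoInDistribution T atTop T' (fun _ => P) P' ∧
    (∀ n, Integrable (T n) P) ∧ Integrable T' P' ∧
    Tendsto (fun n => ∫ ω, T n ω ∂P) atTop (𝓝 (∫ ω, T' ω ∂P'))

/-- Convergence in distribution of `[0, ∞]`-valued random variables, together with convergence of
their expectations in `[0, ∞]`. -/
def ConvergesInLawAndMeanENN (T : ℕ → Ω → ℝ≥0∞) (T' : Ω' → ℝ≥0∞)
    (P : Measure Ω) [IsProbabilityMeasure P] (P' : Measure Ω') [IsProbabilityMeasure P'] : Prop :=
  TendstoInDistribution T atTop T' (fun _ => P) P' ∧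
    Tendsto (fun n => ∫⁻ ω, T n ω ∂P) atTop (𝓝 (∫⁻ ω, T' ω ∂P'))

/-- For an estimator `phat` of `p` and a process `y`: with `Z_n = √n (q̂_n - q)` and
`Z_x = -(x+1) (y_{x+1} - y_x)`, for every `1 ≤ k ≤ ∞` one has `Z_n ⇒ Z` in `ℓ_k`; the norms
`‖Z_n‖_k` converge to `‖Z‖_k` in distribution and in expectation, as do their `k`-th powers if
`k < ∞`; and `n H²(q̂_n, q)` converges to `⅛ ∑_{x ≤ κ} Z_x² / q_x` in distribution and in
expectation. -/
def MixingRate (p : ℕ → ℝ) (phat : ℕ → Ω → ℕ → ℝ) (y : Ω' → ℕ → ℝ)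
    (P : Measure Ω) [IsProbabilityMeasure P] (P' : Measure Ω') [IsProbabilityMeasure P'] : Prop :=
  (∀ (k : ℝ≥0∞) [Fact (1 ≤ k)],
    WeaklyConvergesInEll k (mixingFluctuation p phat) (fun ω => mixing (y ω)) P P' ∧
    ConvergesInLawAndMean (fun n ω => ‖toEll k (mixingFluctuation p phat n ω)‖)
      (fun ω => ‖toEll k (mixing (y ω))‖) P P' ∧
    (k ≠ ∞ → ConvergesInLawAndMean
      (fun n ω => ‖toEll k (mixingFluctuation p phat n ω)‖ ^ k.toReal)
      (fun ω => ‖toEll k (mixing (y ω))‖ ^ k.toReal) P P')) ∧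
  ConvergesInLawAndMeanENN (fun n ω => (n : ℝ≥0∞) * hellingerSq (mixing (phat n ω)) (mixing p))
    (fun ω => weightedSq p (mixing (y ω))) P P'

end DiscreteMonotone

end

namespace DiscreteMonotone

set_option linter.unusedSectionVars false

/-! ### Convergence in distribution -/

section Convergence

variable {Ω Ω' E S : Type*}

/-! The support of `p` is finite, so the problem is finite-dimensional, and the multivariate central
limit theorem gives √n(p̂ₙ - p) ⇒ Y (`tendstoInDistribution_empiricalFluctuation`). The rest is
deterministic analysis of the operators near `p`.

Distinct intervals of constancy of `p` are separated by jumps. A small perturbation of `p` therefore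
cannot make `rear` or `gren` mix two intervals, and on a single interval the constant value of `p`
can be subtracted (`splits_rear`, `splits_gren`). Positive homogeneity moves √n inside the operator.
Hence, once p̂ₙ is close to `p`, the fluctuation of the estimator equals a fixed continuous function
of the empirical process (`exists_estimator_fluctuation_eq`). The extended continuous mapping
theorem `tendstoInDistribution_of_nearFilter` turns this into weak convergence. The empirical mass
function is covered by the same argument with `truncate` as operator.

For expectations, all norms are dominated by a multiple of the ℓ₁ norm of the empirical process
(`exists_mixingFluctuation_le`), whose moments are bounded uniformly in n by Hoeffding's lemma
(`exists_lintegral_pow_le`). Bounded second moments give uniform integrability.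

In the Hellinger statistic a point with q_x > 0 obeys the delta method. A point of the support with
q_x = 0 contributes √n|Z_{n,x}|/2. This diverges if Z_x ≠ 0, but if Z_x = 0 it tends to 0 = 0/0 only
when Z_{n,x} vanishes exactly nearby. For the empirical and rearranged limits Z_x ≠ 0 almost surely,
because Y has no ties on an interval of constancy. For the Grenander limit Z_x may vanish, but
almost surely no flat stretch of the majorant touches the partial sums in its interior, so flatness
persists under small perturbations (`ae_mixing_gren_ne_zero_or`). If some q_x = 0 on the support,
the limit has infinite mean (`not_ae_mixing_gren_eq_zero` for `gren`) and lower semicontinuity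
suffices; otherwise domination applies again. -/

/-- The filter on `ℕ × Ω` along which `n → ∞` and `Y n ω → y`, with `ω` ranging over `Ω₀`. -/
def nearFilter [TopologicalSpace E] (Y : ℕ → Ω → E) (Ω₀ : Set Ω) (y : E) : Filter (ℕ × Ω) :=
  comap (fun q => (q.1, Y q.1 q.2)) (atTop ×ˢ 𝓝 y) ⊓ 𝓟 {q | q.2 ∈ Ω₀}

theorem tendsto_fst_nearFilter [TopologicalSpace E] (Y : ℕ → Ω → E) (Ω₀ : Set Ω) (y : E) :
    Tendsto Prod.fst (nearFilter Y Ω₀ y) atTop :=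
  Tendsto.comp (g := Prod.fst) (f := fun q : ℕ × Ω => (q.1, Y q.1 q.2)) tendsto_fst
    (tendsto_comap.mono_left inf_le_left)

theorem tendsto_nearFilter [TopologicalSpace E] (Y : ℕ → Ω → E) (Ω₀ : Set Ω) (y : E) :
    Tendsto (fun q : ℕ × Ω => Y q.1 q.2) (nearFilter Y Ω₀ y) (𝓝 y) :=
  Tendsto.comp (g := Prod.snd) (f := fun q : ℕ × Ω => (q.1, Y q.1 q.2)) tendsto_snd
    (tendsto_comap.mono_left inf_le_left)

theorem eventually_mem_nearFilter [TopologicalSpace E] (Y : ℕ → Ω → E) (Ω₀ : Set Ω) (y : E) :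
    ∀ᶠ q in nearFilter Y Ω₀ y, q.2 ∈ Ω₀ :=
  (inf_le_right : nearFilter Y Ω₀ y ≤ _) (mem_principal_self _)

variable [MeasurableSpace Ω] [MeasurableSpace Ω']
  {P : Measure Ω} [IsProbabilityMeasure P] {P' : Measure Ω'} [IsProbabilityMeasure P']

/-- Extended continuous mapping theorem. -/
theorem tendstoInDistribution_of_nearFilter
    [TopologicalSpace E] [MeasurableSpace E] [OpensMeasurableSpace E] [HasOuterApproxClosed E]
    [TopologicalSpace S] [MeasurableSpace S] [OpensMeasurableSpace S] [HasOuterApproxClosed S]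
    {Y : ℕ → Ω → E} {Y' : Ω' → E} (hY : TendstoInDistribution Y atTop Y' (fun _ => P) P')
    {T : ℕ → Ω → S} {T' : Ω' → S} (hT : ∀ n, AEMeasurable (T n) P) (hT' : AEMeasurable T' P')
    {Ω₀ : Set Ω} (hΩ₀ : ∀ᵐ ω ∂P, ω ∈ Ω₀)
    (h : ∀ᵐ ω' ∂P', Tendsto (fun q : ℕ × Ω => T q.1 q.2) (nearFilter Y Ω₀ (Y' ω')) (𝓝 (T' ω'))) :
    TendstoInDistribution T atTop T' (fun _ => P) P' where
  forall_aemeasurable := hT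
  aemeasurable_limit := hT'
  tendsto := by
    refine tendsto_of_forall_isClosed_limsup_le' fun C hC => ?_
    simp only [ProbabilityMeasure.coe_mk]
    -- `K m` is the closure of all values of `Y n` with `n ≥ m` at which `T n` lies in `C`.
    -- Portmanteau for `Y` bounds the limsup by the mass of every `K m`, and a limit value in all of
    -- them forces `T'` into `C`.
    set K : ℕ → Set E := fun m => closure {e | ∃ n, m ≤ n ∧ ∃ ω ∈ Ω₀, T n ω ∈ C ∧ Y n ω = e} with hK
    have hKc : ∀ m, IsClosed (K m) := fun m => isClosed_closure
    have hKa : Antitone K := by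
      intro a b hab
      refine closure_mono ?_
      rintro e ⟨n, hn, r⟩
      exact ⟨n, hab.trans hn, r⟩
    have step : ∀ m, limsup (fun n => (P.map (T n)) C) atTop ≤ (P'.map Y') (K m) := by
      intro m
      have h1 := ProbabilityMeasure.limsup_measure_closed_le_of_tendsto hY.tendsto (hKc m)
      simp only [ProbabilityMeasure.coe_mk] at h1
      refine le_trans (limsup_le_limsup ?_) h1
      filter_upwards [eventually_ge_atTop m] with n hn
      rw [Measure.map_apply_of_aemeasurable (hT n) hC.measurableSet,
        Measure.map_apply_of_aemeasurable (hY.forall_aemeasurable n) (hKc m).measurableSet]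
      refine measure_mono_ae ?_
      filter_upwards [hΩ₀] with ω hω hωC
      exact subset_closure ⟨n, hn, ω, hω, hωC, rfl⟩
    have hlim : Tendsto (fun m => (P'.map Y') (K m)) atTop (𝓝 ((P'.map Y') (⋂ m, K m))) :=
      haveI := Measure.isProbabilityMeasure_map hY.aemeasurable_limit
      tendsto_measure_iInter_atTop (fun m => (hKc m).measurableSet.nullMeasurableSet) hKa
        ⟨0, measure_ne_top _ _⟩
    refine (ge_of_tendsto' hlim step).trans ?_
    rw [Measure.map_apply_of_aemeasurable hT' hC.measurableSet,
      Measure.map_apply_of_aemeasurable hY.aemeasurable_limit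
        (MeasurableSet.iInter fun m => (hKc m).measurableSet)]
    refine measure_mono_ae ?_
    filter_upwards [h] with ω' hω' hmem
    change Y' ω' ∈ ⋂ m, K m at hmem
    change T' ω' ∈ C
    by_contra hn
    have h2 := hω'.eventually (hC.isOpen_compl.mem_nhds hn)
    rw [nearFilter, eventually_inf_principal, eventually_comap] at h2
    obtain ⟨pa, hpa, pb, hpb, hab⟩ := eventually_prod_iff.1 h2
    obtain ⟨m, hm⟩ := eventually_atTop.1 hpa
    have h3 := Set.mem_iInter.1 hmem m
    rw [hK, mem_closure_iff_frequently] at h3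
    obtain ⟨e, ⟨n, hn, ω, hω, hTC, rfl⟩, he⟩ := (h3.and_eventually hpb).exists
    exact hab (hm n hn) he (n, ω) rfl hω hTC

/-! ### Convergence of expectations from convergence in law -/

theorem tendsto_lintegral_min {T : ℕ → Ω → ℝ≥0∞} {T' : Ω' → ℝ≥0∞}
    (hT : TendstoInDistribution T atTop T' (fun _ => P) P') (M : ℕ) :
    Tendsto (fun n => ∫⁻ ω, min (T n ω) M ∂P) atTop (𝓝 (∫⁻ ω, min (T' ω) M ∂P')) := by
  have hc : Continuous fun t : ℝ≥0∞ => (min t M).toNNReal := by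
    refine ENNReal.continuousOn_toNNReal.comp_continuous (by fun_prop) fun t => ?_
    exact ne_top_of_le_ne_top (ENNReal.natCast_ne_top M) (min_le_right _ _)
  have hcoe : ∀ t : ℝ≥0∞, ((min t M).toNNReal : ℝ≥0∞) = min t M := fun t =>
    ENNReal.coe_toNNReal (ne_top_of_le_ne_top (ENNReal.natCast_ne_top M) (min_le_right _ _))
  have hle : ∀ t : ℝ≥0∞, (min t M).toNNReal ≤ M := fun t => by
    rw [← ENNReal.coe_le_coe, hcoe]
    exact min_le_right _ _
  have h1 := ProbabilityMeasure.tendsto_iff_forall_lintegral_tendsto.1 hT.tendsto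
    (BoundedContinuousFunction.mkOfBound ⟨_, hc⟩ M fun x y => by
      rw [NNReal.dist_eq]
      have hx : ((min x M).toNNReal : ℝ) ≤ M := by exact_mod_cast hle x
      have hy : ((min y M).toNNReal : ℝ) ≤ M := by exact_mod_cast hle y
      exact abs_sub_le_of_nonneg_of_le (NNReal.coe_nonneg _) hx (NNReal.coe_nonneg _) hy)
  simp only [ProbabilityMeasure.coe_mk, BoundedContinuousFunction.mkOfBound_coe,
    ContinuousMap.coe_mk, hcoe] at h1
  rw [lintegral_map' (by fun_prop) hT.aemeasurable_limit] at h1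
  refine h1.congr fun n => ?_
  rw [lintegral_map' (by fun_prop) (hT.forall_aemeasurable n)]

/-- Fatou's lemma for convergence in law: truncations at a level `M` have converging means, and `M →
∞` by monotone convergence on the limit side. -/
theorem lintegral_le_liminf_of_tendstoInDistribution {T : ℕ → Ω → ℝ≥0∞} {T' : Ω' → ℝ≥0∞}
    (hT : TendstoInDistribution T atTop T' (fun _ => P) P') :
    ∫⁻ ω, T' ω ∂P' ≤ liminf (fun n => ∫⁻ ω, T n ω ∂P) atTop := by
  have h1 : Tendsto (fun M : ℕ => ∫⁻ ω, min (T' ω) M ∂P') atTop (𝓝 (∫⁻ ω, T' ω ∂P')) := by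
    refine lintegral_tendsto_of_tendsto_of_monotone
      (fun M => hT.aemeasurable_limit.min aemeasurable_const) ?_ ?_
    · refine ae_of_all _ fun ω a b hab => ?_
      exact min_le_min_left _ (by exact_mod_cast hab)
    · refine ae_of_all _ fun ω => ?_
      have : Tendsto (fun M : ℕ => min (T' ω) (M : ℝ≥0∞)) atTop (𝓝 (min (T' ω) ⊤)) :=
        tendsto_const_nhds.min ENNReal.tendsto_nat_nhds_top
      simpa using this
  refine le_of_tendsto' h1 fun M => ?_
  rw [← (tendsto_lintegral_min hT M).liminf_eq]
  exact liminf_le_liminf (Eventually.of_forall fun n => lintegral_mono fun ω => min_le_left _ _)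

/-- A second-moment bound makes the mass above level `M` of order `1/M` uniformly in `n`, which
complements the Fatou inequality. -/
theorem tendsto_lintegral_of_sq_bounded {T : ℕ → Ω → ℝ≥0∞} {T' : Ω' → ℝ≥0∞}
    (hT : TendstoInDistribution T atTop T' (fun _ => P) P') {C : ℝ≥0∞} (hC : C ≠ ⊤)
    (hb : ∀ n, ∫⁻ ω, T n ω ^ 2 ∂P ≤ C) :
    Tendsto (fun n => ∫⁻ ω, T n ω ∂P) atTop (𝓝 (∫⁻ ω, T' ω ∂P')) := by
  refine tendsto_of_le_liminf_of_limsup_le (lintegral_le_liminf_of_tendstoInDistribution hT) ?_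
  have h2 : ∀ M : ℕ, limsup (fun n => ∫⁻ ω, T n ω ∂P) atTop ≤
      ∫⁻ ω, T' ω ∂P' + C * ((M + 1 : ℕ) : ℝ≥0∞)⁻¹ := by
    intro M
    -- The truncation level is `M + 1` rather than `M` to keep its inverse finite.
    have hpt : ∀ t : ℝ≥0∞, t ≤ min t (M + 1 : ℕ) + t ^ 2 * ((M + 1 : ℕ) : ℝ≥0∞)⁻¹ := by
      intro t
      rcases le_total t (M + 1 : ℕ) with h | h
      · rw [min_eq_left h]; exact le_self_add
      · refine le_trans ?_ le_add_self
        rw [← div_eq_mul_inv, ENNReal.le_div_iff_mul_le (by simp) (by simp), sq]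
        gcongr
    have hle : ∀ n, ∫⁻ ω, T n ω ∂P ≤
        ∫⁻ ω, min (T n ω) (M + 1 : ℕ) ∂P + C * ((M + 1 : ℕ) : ℝ≥0∞)⁻¹ := by
      intro n
      refine (lintegral_mono fun ω => hpt (T n ω)).trans ?_
      rw [lintegral_add_left' ((hT.forall_aemeasurable n).min aemeasurable_const),
        lintegral_mul_const'' _ ((hT.forall_aemeasurable n).pow_const 2)]
      gcongr
      exact hb n
    have h3 : Tendsto (fun n => ∫⁻ ω, min (T n ω) (M + 1 : ℕ) ∂P + C * ((M + 1 : ℕ) : ℝ≥0∞)⁻¹)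
        atTop (𝓝 (∫⁻ ω, min (T' ω) (M + 1 : ℕ) ∂P' + C * ((M + 1 : ℕ) : ℝ≥0∞)⁻¹)) :=
      (tendsto_lintegral_min hT (M + 1)).add tendsto_const_nhds
    refine (limsup_le_limsup (Eventually.of_forall hle)).trans ?_
    rw [h3.limsup_eq]
    gcongr
    exact min_le_left _ _
  have h4 : Tendsto (fun M : ℕ => ∫⁻ ω, T' ω ∂P' + C * ((M + 1 : ℕ) : ℝ≥0∞)⁻¹) atTop
      (𝓝 (∫⁻ ω, T' ω ∂P' + C * 0)) := by
    refine tendsto_const_nhds.add (ENNReal.Tendsto.const_mul ?_ (Or.inr hC))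
    exact ENNReal.tendsto_inv_nat_nhds_zero.comp (tendsto_add_atTop_nat 1)
  simpa using ge_of_tendsto' h4 h2

theorem convergesInLawAndMean_of_sq_bounded {T : ℕ → Ω → ℝ} {T' : Ω' → ℝ}
    (hT : TendstoInDistribution T atTop T' (fun _ => P) P') (h0 : ∀ n ω, 0 ≤ T n ω)
    (h0' : ∀ ω, 0 ≤ T' ω) {C : ℝ≥0∞} (hC : C ≠ ⊤)
    (hb : ∀ n, ∫⁻ ω, ENNReal.ofReal (T n ω) ^ 2 ∂P ≤ C) :
    ConvergesInLawAndMean T T' P P' := by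
  have hT2 : TendstoInDistribution (fun n ω => ENNReal.ofReal (T n ω)) atTop
      (fun ω => ENNReal.ofReal (T' ω)) (fun _ => P) P' :=
    TendstoInDistribution.continuous_comp (g := ENNReal.ofReal) ENNReal.continuous_ofReal hT
  have hlim := tendsto_lintegral_of_sq_bounded hT2 hC hb
  have hb1 : ∀ n, ∫⁻ ω, ENNReal.ofReal (T n ω) ∂P ≤ 1 + C := by
    intro n
    have : ∀ t : ℝ≥0∞, t ≤ 1 + t ^ 2 := by
      intro t
      rcases le_total t 1 with h | h
      · exact h.trans le_self_add
      · refine le_trans ?_ le_add_self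
        calc t = t * 1 := (mul_one t).symm
          _ ≤ t * t := by gcongr
          _ = t ^ 2 := (sq t).symm
    refine (lintegral_mono fun ω => this _).trans ?_
    rw [lintegral_add_left measurable_const]
    simpa using hb n
  have hlimtop : ∫⁻ ω, ENNReal.ofReal (T' ω) ∂P' ≠ ⊤ :=
    ne_top_of_le_ne_top (ENNReal.add_ne_top.2 ⟨ENNReal.one_ne_top, hC⟩) (le_of_tendsto' hlim hb1)
  have hi : ∀ n, Integrable (T n) P := fun n =>
    (lintegral_ofReal_ne_top_iff_integrable (hT.forall_aemeasurable n).aestronglyMeasurable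
      (ae_of_all _ (h0 n))).1
      (ne_top_of_le_ne_top (ENNReal.add_ne_top.2 ⟨ENNReal.one_ne_top, hC⟩) (hb1 n))
  refine ⟨hT, hi, (lintegral_ofReal_ne_top_iff_integrable
    hT.aemeasurable_limit.aestronglyMeasurable (ae_of_all _ h0')).1 hlimtop, ?_⟩
  have := (ENNReal.tendsto_toReal hlimtop).comp hlim
  simp only [Function.comp_def] at this
  rw [integral_eq_lintegral_of_nonneg_ae (ae_of_all _ h0')
    hT.aemeasurable_limit.aestronglyMeasurable]
  refine this.congr fun n => ?_
  rw [integral_eq_lintegral_of_nonneg_ae (ae_of_all _ (h0 n))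
    (hT.forall_aemeasurable n).aestronglyMeasurable]

end Convergence

/-! ### The mass function -/

section MassFunction

variable {p : ℕ → ℝ}

/-- Total mass one makes the support non-empty, so its supremum is attained; monotonicity fills in
everything below. -/
theorem IsDecreasingPMF.pos_iff_le_supportEnd (hp : IsDecreasingPMF p)
    (hκ : BddAbove {x | 0 < p x}) {x : ℕ} : 0 < p x ↔ x ≤ supportEnd p := by
  refine ⟨fun h => le_csSup hκ h, fun h => ?_⟩
  have hne : {x | 0 < p x}.Nonempty := by
    by_contra hne
    have h0 : p = fun _ => 0 := by
      funext y
      exact le_antisymm (not_lt.1 fun hy => hne ⟨y, hy⟩) (hp.nonneg y)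
    have := hp.hasSum
    rw [h0] at this
    exact zero_ne_one (hasSum_zero.unique this)
  have h1 : 0 < p (supportEnd p) := Nat.sSup_mem hne hκ
  exact h1.trans_le (hp.antitone h)

theorem IsDecreasingPMF.eq_zero_of_supportEnd_lt (hp : IsDecreasingPMF p)
    (hκ : BddAbove {x | 0 < p x}) {x : ℕ} (hx : supportEnd p < x) : p x = 0 :=
  le_antisymm (not_lt.1 fun h => (hp.pos_iff_le_supportEnd hκ).1 h |>.not_gt hx) (hp.nonneg x)

theorem IsDecreasingPMF.le_one (hp : IsDecreasingPMF p) (x : ℕ) : p x ≤ 1 :=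
  le_hasSum hp.hasSum x fun y _ => hp.nonneg y

end MassFunction

/-! ### The limit of the empirical process -/

section Gaussian

variable {Ω' : Type*} [MeasurableSpace Ω'] {P' : Measure Ω'} [IsProbabilityMeasure P']
  {p : ℕ → ℝ} {Y : ℕ → Ω' → ℝ}

/-- The quadratic form of the covariance `p_x δ_{x,x'} - p_x p_{x'}`. -/
noncomputable def covarianceForm (p : ℕ → ℝ) (s : Finset ℕ) (c : ℕ → ℝ) : ℝ :=
  ∑ x ∈ s, ∑ x' ∈ s, c x * c x' * ((if x = x' then p x else 0) - p x * p x')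

/-- With `c` cut off outside `s`, this is E c(X)² - (E c(X))². It makes nondegeneracy visible for
contrasts on a level set of `p`. -/
theorem covarianceForm_eq (p : ℕ → ℝ) (s : Finset ℕ) (c : ℕ → ℝ) :
    covarianceForm p s c = ∑ x ∈ s, c x ^ 2 * p x - (∑ x ∈ s, c x * p x) ^ 2 := by
  simp only [covarianceForm, mul_sub, Finset.sum_sub_distrib, mul_ite, mul_zero]
  congr 1
  · refine Finset.sum_congr rfl fun x hx => ?_
    rw [Finset.sum_ite_eq]
    simp [hx, sq]
  · rw [sq, Finset.sum_mul_sum]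
    refine Finset.sum_congr rfl fun x _ => Finset.sum_congr rfl fun x' _ => ?_
    ring

theorem variance_sum_mul {Ω : Type*} [MeasurableSpace Ω] {P : Measure Ω} [IsProbabilityMeasure P]
    {ξ : ℕ → Ω → ℝ} (hξ : ∀ x, MemLp (ξ x) 2 P)
    (hcov : ∀ x x', covariance (ξ x) (ξ x') P = (if x = x' then p x else 0) - p x * p x')
    (s : Finset ℕ) (c : ℕ → ℝ) :
    variance (fun ω => ∑ x ∈ s, c x * ξ x ω) P = covarianceForm p s c := by
  rw [variance_fun_sum' fun x _ => (hξ x).const_mul (c x)]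
  refine Finset.sum_congr rfl fun x _ => Finset.sum_congr rfl fun x' _ => ?_
  rw [covariance_const_mul_left, covariance_const_mul_right, hcov]
  ring

theorem IsLimitGaussian.memLp_two (hY : IsLimitGaussian p Y P') (x : ℕ) : MemLp (Y x) 2 P' :=
  (hY.gaussian.hasGaussianLaw_eval x).memLp_two

theorem IsLimitGaussian.hasLaw_sum (hY : IsLimitGaussian p Y P') (s : Finset ℕ) (c : ℕ → ℝ) :
    HasLaw (fun ω => ∑ x ∈ s, c x * Y x ω)
      (gaussianReal 0 (covarianceForm p s c).toNNReal) P' := by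
  have hg : HasGaussianLaw (fun ω => ∑ x ∈ s, c x * Y x ω) P' := by
    simpa using (hY.gaussian.smul c).hasGaussianLaw_fun_sum (I := s)
  refine ⟨hg.aemeasurable, ?_⟩
  rw [hg.map_eq_gaussianReal, variance_sum_mul hY.memLp_two hY.cov,
    integral_finsetSum _ fun x _ => ((hY.memLp_two x).integrable (by norm_num)).const_mul _]
  simp [integral_const_mul, hY.mean]

/-- A nondegenerate Gaussian law has no atoms. Every statement about ties of the limit reduces to
this. -/
theorem IsLimitGaussian.ae_sum_ne_zero (hY : IsLimitGaussian p Y P') {s : Finset ℕ} {c : ℕ → ℝ}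
    (h : 0 < covarianceForm p s c) : ∀ᵐ ω ∂P', ∑ x ∈ s, c x * Y x ω ≠ 0 := by
  have hl := hY.hasLaw_sum s c
  have : NullSingletonClass (gaussianReal 0 (covarianceForm p s c).toNNReal) :=
    nullSingletonClass_gaussianReal (by simpa using h)
  have h0 : ∀ᵐ y ∂(P'.map fun ω => ∑ x ∈ s, c x * Y x ω), y ≠ 0 := by
    rw [hl.map_eq, ae_iff]
    simp only [not_not, ne_eq, Set.ofPred_eq_eq_singleton]
    exact measure_singleton _
  exact ae_of_ae_map hl.aemeasurable h0

theorem IsLimitGaussian.ae_eq_zero (hY : IsLimitGaussian p Y P') {x : ℕ} (hx : p x = 0) :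
    ∀ᵐ ω ∂P', Y x ω = 0 := by
  have hv : variance (Y x) P' = 0 := by
    rw [← covariance_self (hY.gaussian.aemeasurable x), hY.cov]
    simp [hx]
  have := ae_eq_integral_of_variance_eq_zero (hY.memLp_two x) hv
  filter_upwards [this] with ω hω
  rw [hω, hY.mean]

end Gaussian

/-! ### The empirical process -/

section Empirical

variable {Ω Ω' : Type*} [MeasurableSpace Ω] [MeasurableSpace Ω']
  {P : Measure Ω} [IsProbabilityMeasure P] {P' : Measure Ω'} [IsProbabilityMeasure P']
  {p : ℕ → ℝ} {X : ℕ → Ω → ℕ} {Y : ℕ → Ω' → ℝ}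

/-- The process `√n (p̂_n - p)`. -/
noncomputable def empiricalFluctuation (p : ℕ → ℝ) (X : ℕ → Ω → ℕ) (n : ℕ) (ω : Ω) : ℕ → ℝ :=
  fun x => √(n : ℝ) * (empirical X n ω x - p x)

/-- The indicator of `{X = x}`. -/
noncomputable def hit (X : Ω → ℕ) (x : ℕ) (ω : Ω) : ℝ := if X ω = x then 1 else 0

theorem measurable_hit {X : Ω → ℕ} (hX : Measurable X) (x : ℕ) : Measurable (hit X x) :=
  (measurable_of_countable (fun k : ℕ => if k = x then (1 : ℝ) else 0)).comp hX

omit [MeasurableSpace Ω] in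
theorem hit_mem_Icc (X : Ω → ℕ) (x : ℕ) (ω : Ω) : hit X x ω ∈ Set.Icc (0 : ℝ) 1 := by
  unfold hit; split_ifs <;> simp

theorem memLp_hit {X : Ω → ℕ} (hX : Measurable X) (x : ℕ) : MemLp (hit X x) 2 P :=
  MemLp.of_bound (measurable_hit hX x).aestronglyMeasurable 1 (ae_of_all _ fun ω => by
    have := hit_mem_Icc X x ω
    rw [Real.norm_eq_abs, abs_le]; constructor <;> linarith [this.1, this.2])

theorem integral_hit {X : Ω → ℕ} (hX : Measurable X) (hlaw : ∀ x, P.real {ω | X ω = x} = p x)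
    (x : ℕ) : ∫ ω, hit X x ω ∂P = p x := by
  have hm : MeasurableSet {ω | X ω = x} := hX (measurableSet_singleton x)
  have : hit X x = {ω | X ω = x}.indicator 1 := by
    funext ω; simp [hit, Set.indicator_apply]
  rw [this, integral_indicator_one hm, hlaw]

theorem covariance_hit {X : Ω → ℕ} (hX : Measurable X) (hlaw : ∀ x, P.real {ω | X ω = x} = p x)
    (x x' : ℕ) :
    covariance (hit X x) (hit X x') P = (if x = x' then p x else 0) - p x * p x' := by
  rw [covariance_eq_sub (memLp_hit hX x) (memLp_hit hX x'), integral_hit hX hlaw,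
    integral_hit hX hlaw]
  congr 1
  split_ifs with h
  · subst h
    rw [← integral_hit hX hlaw]
    congr 1; funext ω; simp only [Pi.mul_apply, hit]; split_ifs <;> simp
  · rw [← integral_zero Ω ℝ (μ := P)]
    congr 1; funext ω; simp only [Pi.mul_apply, hit]; split_ifs <;> simp_all

omit [MeasurableSpace Ω] in
theorem empiricalFluctuation_eq (p : ℕ → ℝ) (X : ℕ → Ω → ℕ) (n : ℕ) (ω : Ω) (x : ℕ) :
    empiricalFluctuation p X n ω x = (√(n : ℝ))⁻¹ * ∑ i ∈ Finset.range n, (hit (X i) x ω - p x) := by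
  rcases Nat.eq_zero_or_pos n with rfl | hn
  · simp [empiricalFluctuation]
  have h1 : (0 : ℝ) < n := by exact_mod_cast hn
  have h2 : (√(n : ℝ)) ≠ 0 := (Real.sqrt_pos.2 h1).ne'
  have h3 : (n : ℝ) = √(n : ℝ) * √(n : ℝ) := (Real.mul_self_sqrt h1.le).symm
  simp only [empiricalFluctuation, empirical, Finset.sum_sub_distrib, Finset.sum_const,
    Finset.card_range, nsmul_eq_mul]
  change √(n : ℝ) * ((n : ℝ)⁻¹ * ∑ i ∈ Finset.range n, hit (X i) x ω - p x) = _
  set r := √(n : ℝ)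
  rw [h3]
  field_simp

theorem ae_sample_le (hp : IsDecreasingPMF p) (hκ : BddAbove {x | 0 < p x})
    (hlaw : ∀ i x, P.real {ω | X i ω = x} = p x) :
    ∀ᵐ ω ∂P, ∀ i, X i ω ≤ supportEnd p := by
  refine ae_all_iff.2 fun i => ?_
  have h : ∀ᵐ ω ∂P, ∀ x, supportEnd p < x → X i ω ≠ x := by
    refine ae_all_iff.2 fun x => ?_
    by_cases hx : supportEnd p < x
    · have h0 := hlaw i x
      rw [hp.eq_zero_of_supportEnd_lt hκ hx, measureReal_eq_zero_iff] at h0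
      simpa [ae_iff, hx] using h0
    · exact ae_of_all _ fun ω h => absurd h hx
  filter_upwards [h] with ω hω
  by_contra hn
  exact hω _ (not_le.1 hn) rfl

omit [MeasurableSpace Ω] in
theorem empirical_eq_zero {n : ℕ} {ω : Ω} {x : ℕ} (h : ∀ i < n, X i ω ≠ x) :
    empirical X n ω x = 0 := by
  unfold empirical
  rw [Finset.sum_eq_zero, mul_zero]
  intro i hi
  simp [h i (Finset.mem_range.1 hi)]

omit [MeasurableSpace Ω] in
theorem empirical_nonneg (X : ℕ → Ω → ℕ) (n : ℕ) (ω : Ω) (x : ℕ) : 0 ≤ empirical X n ω x := by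
  unfold empirical
  refine mul_nonneg (by positivity) (Finset.sum_nonneg fun i _ => ?_)
  split_ifs <;> simp

theorem measurable_empiricalFluctuation (hX : ∀ i, Measurable (X i)) (n : ℕ) :
    Measurable (empiricalFluctuation p X n) := by
  refine measurable_pi_iff.2 fun x => ?_
  simp only [empiricalFluctuation_eq]
  exact (Finset.measurable_sum _ fun i _ => (measurable_hit (hX i) x).sub_const _).const_mul _

/-- The one-dimensional central limit theorem for linear functionals of the empirical process. -/
theorem tendstoInDistribution_sum_empiricalFluctuation
    (hX : ∀ i, Measurable (X i)) (hindep : iIndepFun X P)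
    (hlaw : ∀ i x, P.real {ω | X i ω = x} = p x) (hY : IsLimitGaussian p Y P')
    (s : Finset ℕ) (c : ℕ → ℝ) :
    TendstoInDistribution (fun n ω => ∑ x ∈ s, c x * empiricalFluctuation p X n ω x) atTop
      (fun ω => ∑ x ∈ s, c x * Y x ω) (fun _ => P) P' := by
  -- A linear functional of the empirical process is a normalized sum of the i.i.d. variables `g (X
  -- i)`.
  set g : ℕ → ℝ := fun k => ∑ x ∈ s, c x * if k = x then (1 : ℝ) else 0 with hg
  have hgm : Measurable g := measurable_of_countable g
  have hid : ∀ i, IdentDistrib (X i) (X 0) P P := by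
    intro i
    refine ⟨(hX i).aemeasurable, (hX 0).aemeasurable, ?_⟩
    refine Measure.ext_of_singleton fun x => ?_
    rw [Measure.map_apply (hX i) (measurableSet_singleton x),
      Measure.map_apply (hX 0) (measurableSet_singleton x)]
    have := (hlaw i x).trans (hlaw 0 x).symm
    exact (measureReal_eq_measureReal_iff).1 this
  have hgX : ∀ i, (fun ω => g (X i ω)) = fun ω => ∑ x ∈ s, c x * hit (X i) x ω := fun i => rfl
  have hmem : MemLp (fun ω => g (X 0 ω)) 2 P := by
    rw [hgX]
    exact memLp_finsetSum _ fun x _ => (memLp_hit (hX 0) x).const_mul _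
  have hvar : variance (fun ω => g (X 0 ω)) P = covarianceForm p s c := by
    rw [hgX]
    exact variance_sum_mul (memLp_hit (hX 0)) (covariance_hit (hX 0) (hlaw 0)) s c
  have hmean : ∫ ω, g (X 0 ω) ∂P = ∑ x ∈ s, c x * p x := by
    have : ∀ ω, g (X 0 ω) = ∑ x ∈ s, c x * hit (X 0) x ω := fun ω => rfl
    simp only [this]
    rw [integral_finsetSum _ fun x _ =>
      ((memLp_hit (P := P) (hX 0) x).integrable (by norm_num)).const_mul _]
    simp [integral_const_mul, integral_hit (hX 0) (hlaw 0)]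
  have hclt := tendstoInDistribution_inv_sqrt_mul_sum_sub (X := fun i ω => g (X i ω))
    (Y := fun ω => ∑ x ∈ s, c x * Y x ω) (P := P) (P' := P')
    (by rw [hvar]; exact hY.hasLaw_sum s c) hmem
    (hindep.comp (fun _ => g) fun _ => hgm) (fun i => (hid i).comp hgm)
  convert! hclt using 3 with n ω
  rw [hmean]
  simp only [empiricalFluctuation_eq, Finset.sum_sub_distrib, Finset.sum_const, Finset.card_range,
    nsmul_eq_mul, hg, hit]
  rw [Finset.sum_comm (s := Finset.range n), Finset.mul_sum, ← Finset.sum_sub_distrib,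
    Finset.mul_sum]
  refine Finset.sum_congr rfl fun x _ => ?_
  rw [← Finset.mul_sum]
  ring

/-- The central limit theorem for the empirical process. -/
theorem tendstoInDistribution_empiricalFluctuation
    (hp : IsDecreasingPMF p) (hκ : BddAbove {x | 0 < p x})
    (hX : ∀ i, Measurable (X i)) (hindep : iIndepFun X P)
    (hlaw : ∀ i x, P.real {ω | X i ω = x} = p x) (hY : IsLimitGaussian p Y P') :
    TendstoInDistribution (empiricalFluctuation p X) atTop (fun ω x => Y x ω) (fun _ => P) P' := by
  set m := supportEnd p + 1 with hm
  -- Extension by zero. Convergence is proved for the coordinates in the support and carried to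
  -- sequences by this continuous map.
  let e : EuclideanSpace ℝ (Fin m) → ℕ → ℝ := fun v x => if h : x < m then v ⟨x, h⟩ else 0
  have he : Continuous e := by
    refine continuous_pi fun x => ?_
    by_cases h : x < m
    · simp only [e, h, dif_pos]; fun_prop
    · simp only [e, h, dif_neg, not_false_iff]; fun_prop
  have key : TendstoInDistribution
      (fun n ω => WithLp.toLp 2 (fun i : Fin m => empiricalFluctuation p X n ω i)) atTop
      (fun ω => WithLp.toLp 2 (fun i : Fin m => Y i ω)) (fun _ => P) P' := by
    have hm1 : ∀ n, AEMeasurable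
        (fun ω => WithLp.toLp 2 (fun i : Fin m => empiricalFluctuation p X n ω i)) P := by
      intro n
      refine Measurable.aemeasurable ?_
      refine (PiLp.continuous_toLp 2 _).measurable.comp (measurable_pi_iff.2 fun i => ?_)
      exact measurable_pi_iff.1 (measurable_empiricalFluctuation hX n) i
    have hm2 : AEMeasurable (fun ω => WithLp.toLp 2 (fun i : Fin m => Y i ω)) P' := by
      refine (PiLp.continuous_toLp 2 _).measurable.comp_aemeasurable
        (aemeasurable_pi_iff.2 fun i => ?_)
      exact hY.gaussian.aemeasurable i
    refine ⟨hm1, hm2, ProbabilityMeasure.tendsto_iff_tendsto_charFun.2 fun t => ?_⟩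
    simp only [ProbabilityMeasure.coe_mk]
    let c : ℕ → ℝ := e t
    -- Cramér–Wold: the characteristic function of the vector at `t` is that of the linear
    -- functional with coefficients `t`, evaluated at 1.
    have h1 := tendstoInDistribution_sum_empiricalFluctuation hX hindep hlaw hY (Finset.range m) c
    have h2 := ProbabilityMeasure.tendsto_iff_tendsto_charFun.1 h1.tendsto 1
    simp only [ProbabilityMeasure.coe_mk] at h2
    have hinner : ∀ y : ℕ → ℝ, inner ℝ (WithLp.toLp 2 (fun i : Fin m => y i)) t =
        ∑ x ∈ Finset.range m, c x * y x := by
      intro y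
      rw [PiLp.inner_apply, ← Fin.sum_univ_eq_sum_range fun x => c x * y x]
      refine Finset.sum_congr rfl fun i _ => ?_
      simp [c, e]
    have hl1 : charFun (P'.map fun ω => WithLp.toLp 2 (fun i : Fin m => Y i ω)) t =
        charFun (P'.map fun ω => ∑ x ∈ Finset.range m, c x * Y x ω) 1 := by
      rw [charFun_apply, charFun_apply_real, integral_map hm2 (by fun_prop),
        integral_map h1.aemeasurable_limit (by fun_prop)]
      refine integral_congr_ae (ae_of_all _ fun ω => ?_)
      simp [hinner fun x => Y x ω]
    rw [hl1]
    refine h2.congr fun n => ?_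
    rw [charFun_apply_real, charFun_apply, integral_map (hm1 n) (by fun_prop),
      integral_map (h1.forall_aemeasurable n) (by fun_prop)]
    simp [hinner]
  have h3 := key.continuous_comp he
  refine h3.congr (fun n => ?_) ?_
  · filter_upwards [ae_sample_le hp hκ hlaw] with ω hω
    funext x
    simp only [Function.comp_apply, e]
    split_ifs with h
    · rfl
    · have hx : supportEnd p < x := by omega
      rw [empiricalFluctuation, empirical_eq_zero fun i _ => (hω i |>.trans_lt hx).ne,
        hp.eq_zero_of_supportEnd_lt hκ hx]
      simp
  · have : ∀ᵐ ω ∂P', ∀ x, supportEnd p < x → Y x ω = 0 := by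
      refine ae_all_iff.2 fun x => ?_
      by_cases hx : supportEnd p < x
      · filter_upwards [hY.ae_eq_zero (hp.eq_zero_of_supportEnd_lt hκ hx)] with ω hω _ using hω
      · exact ae_of_all _ fun ω h => absurd h hx
    filter_upwards [this] with ω hω
    funext x
    simp only [Function.comp_apply, e]
    split_ifs with h
    · rfl
    · exact (hω x (by omega)).symm

/-! ### Moments of the empirical process -/

/-- Hoeffding: each centred indicator is sub-Gaussian with parameter 1/4, so the normalized sum has
exponential moment at most exp(1/8) at `t = ±1`, whatever `n` is. -/
theorem lintegral_exp_empiricalFluctuation_le (hX : ∀ i, Measurable (X i)) (hindep : iIndepFun X P)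
    (hlaw : ∀ i x, P.real {ω | X i ω = x} = p x) (n x : ℕ) {t : ℝ} (ht : t ^ 2 = 1) :
    ∫⁻ ω, ENNReal.ofReal (Real.exp (t * empiricalFluctuation p X n ω x)) ∂P ≤
      ENNReal.ofReal (Real.exp 1) := by
  have hs : ∀ i, HasSubgaussianMGF (fun ω => hit (X i) x ω - p x) ((‖(1 : ℝ) - 0‖₊ / 2) ^ 2) P := by
    intro i
    rw [← integral_hit (hX i) (hlaw i) x]
    exact hasSubgaussianMGF_of_mem_Icc (measurable_hit (hX i) x).aemeasurable
      (ae_of_all _ (hit_mem_Icc (X i) x))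
  have hi : iIndepFun (fun i ω => hit (X i) x ω - p x) P :=
    hindep.comp (fun _ k => (if k = x then (1 : ℝ) else 0) - p x)
      fun _ => measurable_of_countable _
  have hsum := HasSubgaussianMGF.sum_of_iIndepFun hi (s := Finset.range n) fun i _ => hs i
  have hmul : ∀ ω, t * empiricalFluctuation p X n ω x =
      (t * (√(n : ℝ))⁻¹) * ∑ i ∈ Finset.range n, (hit (X i) x ω - p x) := by
    intro ω
    rw [empiricalFluctuation_eq, mul_assoc]
  simp only [hmul]
  rw [← ofReal_integral_eq_lintegral_ofReal]
  · refine ENNReal.ofReal_le_ofReal ((hsum.mgf_le _).trans (Real.exp_le_exp.2 ?_))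
    rw [mul_pow, ht, inv_pow, Real.sq_sqrt (Nat.cast_nonneg n)]
    rcases Nat.eq_zero_or_pos n with rfl | hn
    · simp
    have h0 : (0 : ℝ) < n := by exact_mod_cast hn
    simp
    field_simp
    norm_num
  · exact hsum.integrable_exp_mul _
  · exact ae_of_all _ fun ω => (Real.exp_pos _).le

/-- Powers are dominated by exponentials, |y|^(N+1) ≤ (N+1)! (e^y + e^(-y)), and the power mean
inequality reduces the sum to single coordinates. -/
theorem exists_lintegral_pow_le (hX : ∀ i, Measurable (X i)) (hindep : iIndepFun X P)
    (hlaw : ∀ i x, P.real {ω | X i ω = x} = p x) (m N : ℕ) :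
    ∃ C : ℝ≥0∞, C ≠ ⊤ ∧ ∀ n, ∫⁻ ω, ENNReal.ofReal
      ((∑ x ∈ Finset.range m, |empiricalFluctuation p X n ω x|) ^ (N + 1)) ∂P ≤ C := by
  have hpow : ∀ y : ℝ, |y| ^ (N + 1) ≤
      ((N + 1).factorial : ℝ) * (Real.exp (1 * y) + Real.exp (-1 * y)) := by
    intro y
    have h1 := Real.pow_div_factorial_le_exp |y| (abs_nonneg y) (N + 1)
    rw [div_le_iff₀ (by positivity)] at h1
    have h2 : Real.exp |y| ≤ Real.exp (1 * y) + Real.exp (-1 * y) := by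
      rcases abs_cases y with ⟨h, _⟩ | ⟨h, _⟩ <;> rw [h]
      · simpa using (Real.exp_pos _).le
      · simpa using (Real.exp_pos _).le
    calc |y| ^ (N + 1) ≤ Real.exp |y| * ((N + 1).factorial : ℝ) := h1
      _ ≤ (Real.exp (1 * y) + Real.exp (-1 * y)) * ((N + 1).factorial : ℝ) := by gcongr
      _ = _ := mul_comm _ _
  set A : ℝ := (m : ℝ) ^ N * ((N + 1).factorial : ℝ) with hA
  have hA0 : 0 ≤ A := by positivity
  have hsum : ∀ y : ℕ → ℝ, (∑ x ∈ Finset.range m, |y x|) ^ (N + 1) ≤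
      A * ∑ x ∈ Finset.range m, (Real.exp (1 * y x) + Real.exp (-1 * y x)) := by
    intro y
    rcases Nat.eq_zero_or_pos m with rfl | hm
    · simp
    have h1 := pow_sum_div_card_le_sum_pow (s := Finset.range m) (f := fun x => |y x|)
      (fun x _ => abs_nonneg _) N
    rw [div_le_iff₀ (by simp; positivity), Finset.card_range] at h1
    refine h1.trans ?_
    rw [hA, mul_comm, mul_assoc]
    refine mul_le_mul_of_nonneg_left ?_ (by positivity)
    rw [Finset.mul_sum]
    exact Finset.sum_le_sum fun x _ => hpow _
  refine ⟨ENNReal.ofReal A * ∑ x ∈ Finset.range m,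
    (ENNReal.ofReal (Real.exp 1) + ENNReal.ofReal (Real.exp 1)), ?_, fun n => ?_⟩
  · exact ENNReal.mul_ne_top ENNReal.ofReal_ne_top
      (ENNReal.sum_ne_top.2 fun x _ => ENNReal.add_ne_top.2
        ⟨ENNReal.ofReal_ne_top, ENNReal.ofReal_ne_top⟩)
  · refine (lintegral_mono fun ω => ENNReal.ofReal_le_ofReal (hsum _)).trans ?_
    have hmx : ∀ x, Measurable fun ω => empiricalFluctuation p X n ω x := fun x =>
      measurable_pi_iff.1 (measurable_empiricalFluctuation hX n) x
    have hme : ∀ (t : ℝ) x, Measurable fun ω =>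
        ENNReal.ofReal (Real.exp (t * empiricalFluctuation p X n ω x)) := fun t x =>
      ((hmx x).const_mul t).exp.ennreal_ofReal
    simp only [ENNReal.ofReal_mul hA0]
    rw [lintegral_const_mul]
    swap
    · exact (Finset.measurable_sum _ fun x _ =>
        ((hmx x).const_mul 1).exp.add ((hmx x).const_mul (-1)).exp).ennreal_ofReal
    gcongr
    have : ∀ ω, ENNReal.ofReal (∑ x ∈ Finset.range m, (Real.exp (1 * empiricalFluctuation p X n ω x) +
        Real.exp (-1 * empiricalFluctuation p X n ω x))) = ∑ x ∈ Finset.range m,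
        (ENNReal.ofReal (Real.exp (1 * empiricalFluctuation p X n ω x)) +
          ENNReal.ofReal (Real.exp (-1 * empiricalFluctuation p X n ω x))) := by
      intro ω
      rw [ENNReal.ofReal_sum_of_nonneg fun x _ => by positivity]
      refine Finset.sum_congr rfl fun x _ => ?_
      rw [ENNReal.ofReal_add (Real.exp_pos _).le (Real.exp_pos _).le]
    simp only [this]
    rw [lintegral_finsetSum (μ := P) (Finset.range m) (f := fun x ω =>
      ENNReal.ofReal (Real.exp (1 * empiricalFluctuation p X n ω x)) +
        ENNReal.ofReal (Real.exp (-1 * empiricalFluctuation p X n ω x)))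
      fun x _ => (hme 1 x).add (hme (-1) x)]
    refine Finset.sum_le_sum fun x _ => ?_
    rw [lintegral_add_left (hme 1 x)]
    exact add_le_add (lintegral_exp_empiricalFluctuation_le hX hindep hlaw n x (by norm_num))
      (lintegral_exp_empiricalFluctuation_le hX hindep hlaw n x (by norm_num))

end Empirical

/-! ### Characterization of `rear` -/

/-- `s` is the decreasing rearrangement of `w` on `{0, …, m - 1}`. -/
structure IsRear (m : ℕ) (w s : ℕ → ℝ) : Prop where
  antitone : ∀ i j, i ≤ j → j < m → s j ≤ s i
  sum_comp : ∀ f : ℝ → ℝ, ∑ i ∈ Finset.range m, f (s i) = ∑ i ∈ Finset.range m, f (w i)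

theorem rear_of_le {m : ℕ} {w : ℕ → ℝ} {x : ℕ} (h : m ≤ x) : rear m w x = 0 := by
  simp [rear, h.not_gt]

theorem isRear_rear (m : ℕ) (w : ℕ → ℝ) : IsRear m w (rear m w) where
  antitone i j hij hj := by
    have hi : i < m := hij.trans_lt hj
    have := Tuple.monotone_sort (fun i : Fin m => -w i) (show (⟨i, hi⟩ : Fin m) ≤ ⟨j, hj⟩ from hij)
    simp only [rear, hi, hj, dif_pos]
    simpa using this
  sum_comp f := by
    rw [← Fin.sum_univ_eq_sum_range (fun i => f (rear m w i)),
      ← Fin.sum_univ_eq_sum_range (fun i => f (w i)),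
      ← Equiv.sum_comp (Tuple.sort fun i : Fin m => -w i) (fun i : Fin m => f (w i))]
    refine Finset.sum_congr rfl fun i _ => ?_
    simp [rear]

namespace IsRear

variable {m : ℕ} {w w' s s' : ℕ → ℝ}

/-- The number of entries above a level is invariant under rearrangement, and for a decreasing
sequence it determines which entries are above that level. -/
theorem le_iff (h : IsRear m w s) {x : ℕ} (hx : x < m) (t : ℝ) :
    t ≤ s x ↔ x < ((Finset.range m).filter fun i => t ≤ w i).card := by
  have hc : ((Finset.range m).filter fun i => t ≤ s i).card =
      ((Finset.range m).filter fun i => t ≤ w i).card := by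
    have h1 := h.sum_comp fun y => if t ≤ y then 1 else 0
    simp only [Finset.sum_boole] at h1
    exact_mod_cast h1
  rw [← hc]
  constructor
  · intro ht
    have : Finset.range (x + 1) ⊆ (Finset.range m).filter fun i => t ≤ s i := by
      intro i hi
      rw [Finset.mem_range] at hi
      rw [Finset.mem_filter, Finset.mem_range]
      exact ⟨by omega, ht.trans (h.antitone i x (by omega) hx)⟩
    simpa using Finset.card_le_card this
  · intro hlt
    by_contra ht
    have : ((Finset.range m).filter fun i => t ≤ s i) ⊆ Finset.range x := by
      intro i hi
      rw [Finset.mem_filter, Finset.mem_range] at hi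
      rw [Finset.mem_range]
      by_contra hxi
      exact ht (hi.2.trans (h.antitone x i (not_lt.1 hxi) hi.1))
    have := Finset.card_le_card this
    rw [Finset.card_range] at this
    omega

/-- Raising the entries can only raise the counts in `le_iff`. With `δ = 0` this gives uniqueness,
with general `δ` the Lipschitz bound. -/
theorem le_add (h : IsRear m w s) (h' : IsRear m w' s') {δ : ℝ}
    (hw : ∀ i < m, w i ≤ w' i + δ) {x : ℕ} (hx : x < m) : s x ≤ s' x + δ := by
  have h1 : s x - δ ≤ s' x := by
    rw [h'.le_iff hx]
    refine ((h.le_iff hx _).1 le_rfl).trans_le (Finset.card_le_card ?_)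
    intro i hi
    rw [Finset.mem_filter, Finset.mem_range] at hi ⊢
    exact ⟨hi.1, by linarith [hw i hi.1]⟩
  linarith

theorem eq_rear (h : IsRear m w s) {x : ℕ} (hx : x < m) : s x = rear m w x := by
  refine le_antisymm ?_ ?_
  · simpa using h.le_add (isRear_rear m w) (δ := 0) (by simp) hx
  · simpa using (isRear_rear m w).le_add h (δ := 0) (by simp) hx

theorem const_mul (h : IsRear m w s) {c : ℝ} (hc : 0 ≤ c) :
    IsRear m (fun i => c * w i) (fun i => c * s i) where
  antitone i j hij hj := mul_le_mul_of_nonneg_left (h.antitone i j hij hj) hc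
  sum_comp f := h.sum_comp fun y => f (c * y)

end IsRear

/-! ### Characterization of `gren` -/

/-- The conditions characterizing the slopes `s` of the least concave majorant of the partial sums
of `w` on `{0, …, m - 1}`. -/
structure IsGren (m : ℕ) (w s : ℕ → ℝ) : Prop where
  succ_le : ∀ i, i + 1 < m → s (i + 1) ≤ s i
  sum_le : ∀ j ≤ m, ∑ i ∈ Finset.range j, w i ≤ ∑ i ∈ Finset.range j, s i
  sum_eq : ∑ i ∈ Finset.range m, s i = ∑ i ∈ Finset.range m, w i
  flat_or_touch : ∀ j, j + 1 < m →
    s j = s (j + 1) ∨ ∑ i ∈ Finset.range (j + 1), s i = ∑ i ∈ Finset.range (j + 1), w i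

theorem gren_of_le {m : ℕ} {w : ℕ → ℝ} {x : ℕ} (h : m ≤ x) : gren m w x = 0 := by
  simp [gren, h.not_gt]

namespace IsGren

variable {m : ℕ} {w w' s s' : ℕ → ℝ}

theorem antitone (h : IsGren m w s) {i j : ℕ} (hij : i ≤ j) (hj : j < m) : s j ≤ s i := by
  induction j, hij using Nat.le_induction with
  | base => exact le_rfl
  | succ k hk ih => exact (h.succ_le k hj).trans (ih (by omega))

/-- A discretely concave majorant of the partial sums lies above the sums of `s`. -/
theorem sum_le_of_concave (h : IsGren m w s) {g : ℕ → ℝ}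
    (hg : ∀ k, k + 2 ≤ m → g k + g (k + 2) ≤ 2 * g (k + 1))
    (hS : ∀ j ≤ m, ∑ i ∈ Finset.range j, w i ≤ g j) {j : ℕ} (hj : j ≤ m) :
    ∑ i ∈ Finset.range j, s i ≤ g j := by
  by_contra hlt
  -- Consider the first minimizer `k` of `d`, where `d k < 0`. The sums of `s` cannot touch those of
  -- `w` there, so `k` is interior and `s` is flat across `k`. Then `d` inherits from `g` concavity
  -- at `k`, whereas `d (k - 1) > d k ≤ d (k + 1)`.
  set d : ℕ → ℝ := fun k => g k - ∑ i ∈ Finset.range k, s i with hd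
  obtain ⟨a, ha, hmin⟩ := Finset.exists_min_image (Finset.range (m + 1)) d ⟨0, by simp⟩
  have hex : ∃ k, k ≤ m ∧ d k = d a := ⟨a, by simpa [Nat.lt_succ_iff] using ha, rfl⟩
  classical
  obtain ⟨hkm, hk⟩ := Nat.find_spec hex
  have hfirst := fun l (hl : l < Nat.find hex) => Nat.find_min hex hl
  set k := Nat.find hex
  have hneg : d k < 0 := by
    have := hmin j (by simp; omega)
    have h2 : d j < 0 := by simp only [hd]; linarith
    linarith
  have htouch : ∑ i ∈ Finset.range k, s i ≠ ∑ i ∈ Finset.range k, w i := by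
    intro he
    have := hS k hkm
    simp only [hd] at hneg
    linarith
  have hk0 : k ≠ 0 := by
    intro h0
    rw [h0] at htouch
    simp at htouch
  have hkm' : k ≠ m := by
    intro h0
    rw [h0] at htouch
    exact htouch h.sum_eq
  obtain ⟨l, hl⟩ := Nat.exists_eq_succ_of_ne_zero hk0
  rw [Nat.succ_eq_add_one] at hl
  have hs := (h.flat_or_touch l (by omega)).resolve_right (by rwa [← hl])
  have h1 : d k < d l := by
    rw [hk]
    refine lt_of_le_of_ne (hmin l (by simp; omega)) fun he => ?_
    exact hfirst l (by omega) ⟨by omega, he.symm⟩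
  have h2 : d k ≤ d (l + 2) := by
    rw [hk]
    exact hmin _ (by simp; omega)
  have h3 := hg l (by omega)
  rw [hl] at h1 h2
  simp only [hd, Finset.sum_range_succ] at h1 h2
  linarith

theorem sum_le_tangent (h : IsGren m w s) {i j : ℕ} (hi : i < m) (hj : j ≤ m) :
    ∑ k ∈ Finset.range j, s k ≤ ∑ k ∈ Finset.range i, s k + s i * ((j : ℝ) - i) := by
  rcases le_total i j with hij | hij
  · have h1 : ∑ k ∈ Finset.Ico i j, s k ≤ (Finset.Ico i j).card • s i :=
      Finset.sum_le_card_nsmul _ _ _ fun k hk => by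
        rw [Finset.mem_Ico] at hk
        exact h.antitone hk.1 (by omega)
    rw [Finset.sum_Ico_eq_sub _ hij, Nat.card_Ico, nsmul_eq_mul, Nat.cast_sub hij] at h1
    linarith
  · have h1 : (Finset.Ico j i).card • s i ≤ ∑ k ∈ Finset.Ico j i, s k :=
      Finset.card_nsmul_le_sum _ _ _ fun k hk => by
        rw [Finset.mem_Ico] at hk
        exact h.antitone hk.2.le hi
    rw [Finset.sum_Ico_eq_sub _ hij, Nat.card_Ico, nsmul_eq_mul, Nat.cast_sub hij] at h1
    linarith

/-- The minimum of the tangent lines is an admissible concave function that interpolates the sums of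
`s`; conversely every admissible function restricts to a discretely concave majorant on the
integers. -/
theorem concaveMajorant_eq (h : IsGren m w s) (hm : 0 < m) {j : ℕ} (hj : j ≤ m) :
    concaveMajorant m w j = ∑ i ∈ Finset.range j, s i := by
  have hne : (Finset.range m).Nonempty := ⟨0, by simpa using hm⟩
  set g : ℝ → ℝ := fun t => (Finset.range m).inf' hne fun i =>
    ∑ k ∈ Finset.range i, s k + s i * (t - i) with hg
  have hgj : ∀ k : ℕ, k ≤ m → ∑ i ∈ Finset.range k, s i ≤ g k := fun k hk =>
    Finset.le_inf' _ _ fun i hi => h.sum_le_tangent (Finset.mem_range.1 hi) hk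
  refine IsLeast.csInf_eq ⟨⟨g, ⟨⟨convex_Icc _ _, ?_⟩, ?_⟩, ?_⟩, ?_⟩
  · intro x _ y _ a b ha hb hab
    refine Finset.le_inf' _ _ fun i hi => ?_
    have hx : g x ≤ ∑ k ∈ Finset.range i, s k + s i * (x - i) := Finset.inf'_le _ hi
    have hy : g y ≤ ∑ k ∈ Finset.range i, s k + s i * (y - i) := Finset.inf'_le _ hi
    have h1 := mul_le_mul_of_nonneg_left hx ha
    have h2 := mul_le_mul_of_nonneg_left hy hb
    simp only [smul_eq_mul]
    refine (add_le_add h1 h2).trans (le_of_eq ?_)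
    have hb' : b = 1 - a := by linarith
    subst hb'
    ring
  · exact fun k hk => (h.sum_le k hk).trans (hgj k hk)
  · refine le_antisymm ?_ (hgj j hj)
    rcases hj.lt_or_eq with hlt | rfl
    · refine (Finset.inf'_le _ (Finset.mem_range.2 hlt)).trans (le_of_eq ?_)
      simp
    -- No tangent is attached to the right end point `m`; the one at `m - 1` passes through it.
    · obtain ⟨l, rfl⟩ := Nat.exists_eq_succ_of_ne_zero hm.ne'
      refine (Finset.inf'_le _ (Finset.mem_range.2 (Nat.lt_succ_self l))).trans (le_of_eq ?_)
      rw [Finset.sum_range_succ]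
      push_cast
      ring
  · rintro _ ⟨f, ⟨hf, hfS⟩, rfl⟩
    refine h.sum_le_of_concave (g := fun k : ℕ => f k) (fun k hk => ?_) hfS hj
    have hk' : ((k : ℝ) + 2) ≤ m := by exact_mod_cast hk
    have hx1 : (k : ℝ) ∈ Set.Icc (0 : ℝ) m := ⟨by positivity, by linarith⟩
    have hx2 : (k : ℝ) + 2 ∈ Set.Icc (0 : ℝ) m := ⟨by positivity, hk'⟩
    have h1 := hf.2 hx1 hx2 (show (0 : ℝ) ≤ 1 / 2 by norm_num) (show (0 : ℝ) ≤ 1 / 2 by norm_num)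
      (by norm_num)
    simp only [smul_eq_mul] at h1
    rw [show (1 / 2 * (k : ℝ) + 1 / 2 * ((k : ℝ) + 2)) = (k : ℝ) + 1 by ring] at h1
    push_cast
    linarith

theorem eq_gren (h : IsGren m w s) {x : ℕ} (hx : x < m) : s x = gren m w x := by
  have h1 := h.concaveMajorant_eq (by omega) (show x + 1 ≤ m by omega)
  have h2 := h.concaveMajorant_eq (by omega) hx.le
  push_cast at h1
  simp only [gren, hx, if_pos, h1, h2, Finset.sum_range_succ]
  ring

/-- The slope can change only at a touching point, so it stays constant up to the next one. -/
theorem exists_touch_right (h : IsGren m w s) {a : ℕ} (ha : a < m) :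
    ∃ b, a < b ∧ b ≤ m ∧ ∑ i ∈ Finset.range b, s i = ∑ i ∈ Finset.range b, w i ∧
      ∀ i, a ≤ i → i < b → s i = s a := by
  classical
  have hex : ∃ b, a < b ∧ ∑ i ∈ Finset.range b, s i = ∑ i ∈ Finset.range b, w i :=
    ⟨m, ha, h.sum_eq⟩
  have hm : Nat.find hex ≤ m := Nat.find_min' hex ⟨ha, h.sum_eq⟩
  obtain ⟨h1, h2⟩ := Nat.find_spec hex
  refine ⟨Nat.find hex, h1, hm, h2, fun i hai => ?_⟩
  induction i, hai using Nat.le_induction with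
  | base => exact fun _ => rfl
  | succ k hk ih =>
    intro hlt
    rw [← ih (by omega)]
    refine ((h.flat_or_touch k (by omega)).resolve_right fun ht => ?_).symm
    exact Nat.find_min hex hlt ⟨by omega, ht⟩

theorem exists_touch_left (h : IsGren m w s) {x : ℕ} (hx : x < m) :
    ∃ a ≤ x, ∑ i ∈ Finset.range a, s i = ∑ i ∈ Finset.range a, w i ∧
      ∀ i, a ≤ i → i ≤ x → s i = s x := by
  induction x with
  | zero => exact ⟨0, le_rfl, by simp, fun i _ hi => by rw [Nat.le_zero.1 hi]⟩
  | succ k ih =>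
    rcases h.flat_or_touch k hx with hf | ht
    · obtain ⟨a, ha, hta, hc⟩ := ih (by omega)
      refine ⟨a, by omega, hta, fun i hai hi => ?_⟩
      rcases Nat.lt_or_ge k i with hki | hki
      · rw [show i = k + 1 by omega]
      · rw [hc i hai hki, hf]
    · exact ⟨k + 1, le_rfl, ht, fun i h1 h2 => by rw [le_antisymm h2 h1]⟩

theorem const_mul (h : IsGren m w s) {c : ℝ} (hc : 0 ≤ c) :
    IsGren m (fun i => c * w i) (fun i => c * s i) where
  succ_le i hi := mul_le_mul_of_nonneg_left (h.succ_le i hi) hc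
  sum_le j hj := by
    simp only [← Finset.mul_sum]
    exact mul_le_mul_of_nonneg_left (h.sum_le j hj) hc
  sum_eq := by simp only [← Finset.mul_sum, h.sum_eq]
  flat_or_touch j hj := by
    simp only [← Finset.mul_sum]
    exact (h.flat_or_touch j hj).imp (fun e => by rw [e]) fun e => by rw [e]

/-- The majorant for `w'`, raised by the ℓ₁ distance, is still concave and majorizes the partial
sums of `w`. -/
theorem sum_le_add (h : IsGren m w s) (h' : IsGren m w' s') {j : ℕ} (hj : j ≤ m) :
    ∑ i ∈ Finset.range j, s i ≤
      ∑ i ∈ Finset.range j, s' i + ∑ i ∈ Finset.range m, |w i - w' i| := by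
  refine h.sum_le_of_concave
    (g := fun j => ∑ i ∈ Finset.range j, s' i + ∑ i ∈ Finset.range m, |w i - w' i|)
    (fun k hk => ?_) (fun k hk => ?_) hj
  · have := h'.succ_le k (by omega)
    simp only [Finset.sum_range_succ _ (k + 1), Finset.sum_range_succ _ k]
    linarith
  · have h1 : ∑ i ∈ Finset.range k, w i - ∑ i ∈ Finset.range k, w' i ≤
        ∑ i ∈ Finset.range m, |w i - w' i| := by
      rw [← Finset.sum_sub_distrib]
      refine (Finset.sum_le_sum fun i _ => le_abs_self _).trans ?_
      exact Finset.sum_le_sum_of_subset_of_nonneg (Finset.range_mono hk) fun _ _ _ => abs_nonneg _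
    linarith [h'.sum_le k hk]

theorem abs_sub_le (h : IsGren m w s) (h' : IsGren m w' s') {x : ℕ} (hx : x < m) :
    |s x - s' x| ≤ 2 * ∑ i ∈ Finset.range m, |w i - w' i| := by
  have a1 := h.sum_le_add h' hx.le
  have a2 := h.sum_le_add h' (show x + 1 ≤ m by omega)
  have b1 := h'.sum_le_add h hx.le
  have b2 := h'.sum_le_add h (show x + 1 ≤ m by omega)
  simp only [Finset.sum_range_succ, abs_sub_comm (w' _)] at a2 b1 b2
  rw [abs_le]
  constructor <;> linarith

end IsGren

/-- Greedy construction: the first slope is the largest average over an initial segment, and the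
construction recurs on the remainder. -/
theorem exists_isGren (m : ℕ) (w : ℕ → ℝ) : ∃ s, IsGren m w s := by
  induction m using Nat.strong_induction_on generalizing w with
  | _ m ih =>
  rcases Nat.eq_zero_or_pos m with rfl | hm
  · exact ⟨0, by simp, fun j hj => by simp [Nat.le_zero.1 hj], by simp, by simp⟩
  obtain ⟨b, hb, hmax⟩ := Finset.exists_max_image (Finset.Icc 1 m)
    (fun k : ℕ => (∑ i ∈ Finset.range k, w i) / k) ⟨1, by simp; omega⟩
  rw [Finset.mem_Icc] at hb
  have hb0 : (0 : ℝ) < b := by exact_mod_cast hb.1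
  set v := (∑ i ∈ Finset.range b, w i) / b with hv
  have hvb : ∑ i ∈ Finset.range b, w i = b * v := by rw [hv]; field_simp
  have hle : ∀ k ≤ m, ∑ i ∈ Finset.range k, w i ≤ k * v := by
    intro k hk
    rcases Nat.eq_zero_or_pos k with rfl | hk0
    · simp
    have h1 := hmax k (Finset.mem_Icc.2 ⟨hk0, hk⟩)
    rw [div_le_iff₀ (by exact_mod_cast hk0)] at h1
    linarith
  obtain ⟨s', hs'⟩ := ih (m - b) (by omega) fun i => w (b + i)
  have hsum : ∀ (f : ℕ → ℝ) (k : ℕ), b ≤ k → ∑ i ∈ Finset.range k, f i =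
      ∑ i ∈ Finset.range b, f i + ∑ i ∈ Finset.range (k - b), f (b + i) := by
    intro f k hk
    rw [← Finset.sum_range_add, Nat.add_sub_cancel' hk]
  set s : ℕ → ℝ := fun i => if i < b then v else s' (i - b) with hs
  have hs1 : ∀ i < b, s i = v := fun i hi => by simp [hs, hi]
  have hs2 : ∀ i, s (b + i) = s' i := fun i => by simp [hs]
  have hsum1 : ∀ k ≤ b, ∑ i ∈ Finset.range k, s i = k * v := by
    intro k hk
    rw [Finset.sum_congr rfl fun i hi => hs1 i ((Finset.mem_range.1 hi).trans_le hk)]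
    simp
  have hsum2 : ∀ k, b ≤ k → ∑ i ∈ Finset.range k, s i =
      ∑ i ∈ Finset.range b, w i + ∑ i ∈ Finset.range (k - b), s' i := by
    intro k hk
    rw [hsum s k hk, hsum1 b le_rfl, hvb]
    simp only [hs2]
  -- Up to the first touching point `c` of the remainder, `s' 0` is the average of `w` there. A
  -- value above `v` would give the initial segment of length `b + c` an average larger than the
  -- maximum.
  have h0 : b < m → s' 0 ≤ v := by
    intro hbm
    obtain ⟨c, hc0, hcm, hct, hcc⟩ := hs'.exists_touch_right (show 0 < m - b by omega)
    rw [Finset.sum_congr rfl fun i hi => hcc i (Nat.zero_le _) (Finset.mem_range.1 hi)] at hct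
    have h1 := hle (b + c) (by omega)
    rw [hsum w (b + c) (by omega), Nat.add_sub_cancel_left, hvb, ← hct] at h1
    simp only [Finset.sum_const, Finset.card_range, nsmul_eq_mul, Nat.cast_add] at h1
    have hc : (0 : ℝ) < c := by exact_mod_cast hc0
    have h2 : (c : ℝ) * s' 0 ≤ c * v := by linarith
    exact le_of_mul_le_mul_left h2 hc
  refine ⟨s, ?_, ?_, ?_, ?_⟩
  · intro i hi
    rcases Nat.lt_or_ge (i + 1) b with h | h
    · rw [hs1 _ h, hs1 _ (by omega)]
    · rcases Nat.lt_or_ge i b with h' | h'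
      · rw [show i + 1 = b + 0 by omega, hs2, hs1 i h']
        exact h0 (by omega)
      · obtain ⟨k, rfl⟩ := Nat.exists_eq_add_of_le h'
        rw [add_assoc, hs2, hs2]
        exact hs'.succ_le k (by omega)
  · intro j hj
    rcases le_total j b with h | h
    · rw [hsum1 j h]
      exact hle j hj
    · rw [hsum2 j h, hsum w j h]
      exact add_le_add_right (hs'.sum_le (j - b) (by omega)) _
  · rw [hsum2 m hb.2, hsum w m hb.2, hs'.sum_eq]
  · intro j hj
    rcases Nat.lt_trichotomy (j + 1) b with h | h | h
    · left; rw [hs1 _ h, hs1 _ (by omega)]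
    · right
      rw [h, hsum1 b le_rfl, hvb]
    · obtain ⟨k, rfl⟩ := Nat.exists_eq_add_of_le (show b ≤ j by omega)
      refine (hs'.flat_or_touch k (by omega)).imp (fun e => ?_) fun e => ?_
      · rw [add_assoc, hs2, hs2, e]
      · rw [hsum2 _ (by omega), hsum w (b + k + 1) (by omega), show b + k + 1 - b = k + 1 by omega, e]

theorem isGren_gren (m : ℕ) (w : ℕ → ℝ) : IsGren m w (gren m w) := by
  obtain ⟨s, hs⟩ := exists_isGren m w
  have he : ∀ j ≤ m, ∑ i ∈ Finset.range j, gren m w i = ∑ i ∈ Finset.range j, s i := fun j hj =>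
    Finset.sum_congr rfl fun i hi => (hs.eq_gren ((Finset.mem_range.1 hi).trans_le hj)).symm
  refine ⟨fun i hi => ?_, fun j hj => ?_, ?_, fun j hj => ?_⟩
  · rw [← hs.eq_gren hi, ← hs.eq_gren (by omega)]
    exact hs.succ_le i hi
  · rw [he j hj]
    exact hs.sum_le j hj
  · rw [he m le_rfl, hs.sum_eq]
  · rw [he _ hj.le, ← hs.eq_gren hj, ← hs.eq_gren (show j < m by omega)]
    exact hs.flat_or_touch j hj

/-! ### Vector operators -/

/-- The properties of `rear` and `gren` on which the limit theorem depends. -/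
structure IsRegular (φ : ℕ → (ℕ → ℝ) → ℕ → ℝ) : Prop where
  eq_zero_of_le : ∀ m w x, m ≤ x → φ m w x = 0
  const_mul : ∀ m w (c : ℝ), 0 ≤ c → ∀ x, φ m (fun i => c * w i) x = c * φ m w x
  lipschitz : ∀ m w w' x, |φ m w x - φ m w' x| ≤ 2 * ∑ i ∈ Finset.range m, |w i - w' i|

/-- Restriction of a sequence to `{0, …, m - 1}`. -/
def truncate (m : ℕ) (w : ℕ → ℝ) : ℕ → ℝ := fun x => if x < m then w x else 0

theorem abs_le_sum_range {m : ℕ} (w : ℕ → ℝ) {x : ℕ} (hx : x < m) :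
    |w x| ≤ ∑ i ∈ Finset.range m, |w i| :=
  Finset.single_le_sum (f := fun i => |w i|) (fun _ _ => abs_nonneg _) (Finset.mem_range.2 hx)

/-- Lets the empirical mass function be treated as a third operator alongside `rear` and `gren`. -/
theorem isRegular_truncate : IsRegular truncate where
  eq_zero_of_le m w x h := by simp [truncate, h.not_gt]
  const_mul m w c _ x := by simp [truncate]
  lipschitz m w w' x := by
    have h0 : 0 ≤ ∑ i ∈ Finset.range m, |w i - w' i| := Finset.sum_nonneg fun i _ => abs_nonneg _
    unfold truncate
    split_ifs with h
    · linarith [abs_le_sum_range (fun i => w i - w' i) h]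
    · simpa using h0

theorem isRegular_rear : IsRegular rear where
  eq_zero_of_le m w x h := rear_of_le h
  const_mul m w c hc x := by
    rcases Nat.lt_or_ge x m with hx | hx
    · exact (((isRear_rear m w).const_mul hc).eq_rear hx).symm
    · rw [rear_of_le hx, rear_of_le hx, mul_zero]
  lipschitz m w w' x := by
    have h0 : 0 ≤ ∑ i ∈ Finset.range m, |w i - w' i| := Finset.sum_nonneg fun i _ => abs_nonneg _
    rcases Nat.lt_or_ge x m with hx | hx
    · have key : ∀ i < m, |w i - w' i| ≤ ∑ i ∈ Finset.range m, |w i - w' i| := fun i hi =>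
        abs_le_sum_range (fun i => w i - w' i) hi
      have h1 := (isRear_rear m w).le_add (isRear_rear m w')
        (fun i hi => by linarith [le_abs_self (w i - w' i), key i hi]) hx
      have h2 := (isRear_rear m w').le_add (isRear_rear m w)
        (δ := ∑ i ∈ Finset.range m, |w i - w' i|)
        (fun i hi => by linarith [neg_abs_le (w i - w' i), key i hi]) hx
      rw [abs_le]
      constructor <;> linarith
    · rw [rear_of_le hx, rear_of_le hx, sub_self, abs_zero]
      positivity

theorem isRegular_gren : IsRegular gren where
  eq_zero_of_le m w x h := gren_of_le h
  const_mul m w c hc x := by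
    rcases Nat.lt_or_ge x m with hx | hx
    · exact (((isGren_gren m w).const_mul hc).eq_gren hx).symm
    · rw [gren_of_le hx, gren_of_le hx, mul_zero]
  lipschitz m w w' x := by
    rcases Nat.lt_or_ge x m with hx | hx
    · exact (isGren_gren m w).abs_sub_le (isGren_gren m w') hx
    · rw [gren_of_le hx, gren_of_le hx, sub_self, abs_zero]
      exact mul_nonneg (by norm_num) (Finset.sum_nonneg fun i _ => abs_nonneg _)

/-! ### Intervals of constancy -/

/-- First point of the interval of constancy of `p` through `x`. -/
noncomputable def blockStart (p : ℕ → ℝ) (x : ℕ) : ℕ := sInf {z | p z = p x}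

/-- Length of the interval of constancy of `p` through `x`. -/
noncomputable def blockLength (p : ℕ → ℝ) (x : ℕ) : ℕ := {z | p z = p x}.ncard

section Blocks

variable {p : ℕ → ℝ} (hp : IsDecreasingPMF p) (hκ : BddAbove {x | 0 < p x})

include hp hκ

/-- Level sets of a monotone function are order-convex. Positivity of the level keeps this one
bounded, so that its cardinality is its true length. -/
theorem eq_iff_mem_block {x : ℕ} (hx : x ≤ supportEnd p) (z : ℕ) :
    p z = p x ↔ blockStart p x ≤ z ∧ z < blockStart p x + blockLength p x := by
  have hpos := (hp.pos_iff_le_supportEnd hκ).2 hx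
  have hne : {z | p z = p x}.Nonempty := ⟨x, rfl⟩
  have hbdd : BddAbove {z | p z = p x} :=
    ⟨supportEnd p, fun z hz => (hp.pos_iff_le_supportEnd hκ).1 (by rwa [show p z = p x from hz])⟩
  have ha : p (blockStart p x) = p x := Nat.sInf_mem hne
  have hb : p (sSup {z | p z = p x}) = p x := Nat.sSup_mem hne hbdd
  have hset : {z | p z = p x} = Set.Icc (blockStart p x) (sSup {z | p z = p x}) := by
    ext z
    refine ⟨fun hz => ⟨Nat.sInf_le hz, le_csSup hbdd hz⟩, fun hz => ?_⟩
    exact le_antisymm (ha ▸ hp.antitone hz.1) (hb ▸ hp.antitone hz.2)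
  have hle : blockStart p x ≤ sSup {z | p z = p x} := le_csSup hbdd ha
  have hlen : blockLength p x = sSup {z | p z = p x} + 1 - blockStart p x := by
    unfold blockLength
    rw [hset, ← Finset.coe_Icc, Set.ncard_coe_finset, Nat.card_Icc]
    congr 2
    rw [Finset.coe_Icc, ← hset]
  have : p z = p x ↔ z ∈ Set.Icc (blockStart p x) (sSup {z | p z = p x}) := by
    rw [← hset]; rfl
  rw [this, Set.mem_Icc, hlen]
  omega

theorem blockStart_le {x : ℕ} (hx : x ≤ supportEnd p) : blockStart p x ≤ x :=
  ((eq_iff_mem_block hp hκ hx x).1 rfl).1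

theorem lt_blockStart_add {x : ℕ} (hx : x ≤ supportEnd p) :
    x < blockStart p x + blockLength p x :=
  ((eq_iff_mem_block hp hκ hx x).1 rfl).2

theorem apply_blockStart_add {x : ℕ} (hx : x ≤ supportEnd p) {j : ℕ} (hj : j < blockLength p x) :
    p (blockStart p x + j) = p x :=
  (eq_iff_mem_block hp hκ hx _).2 ⟨by omega, by omega⟩

theorem blockStart_add_le {x : ℕ} (hx : x ≤ supportEnd p) :
    blockStart p x + blockLength p x ≤ supportEnd p + 1 := by
  have h1 := blockStart_le hp hκ hx
  have h2 := lt_blockStart_add hp hκ hx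
  have h3 := apply_blockStart_add hp hκ hx (j := blockLength p x - 1) (by omega)
  have h4 := (hp.pos_iff_le_supportEnd hκ).1 (h3 ▸ (hp.pos_iff_le_supportEnd hκ).2 hx)
  omega

theorem blockwise_blockStart_add {x : ℕ} (hx : x ≤ supportEnd p) {j : ℕ}
    (hj : j < blockLength p x) (φ : ℕ → (ℕ → ℝ) → ℕ → ℝ) (y : ℕ → ℝ) :
    blockwise φ p y (blockStart p x + j) =
      φ (blockLength p x) (fun i => y (blockStart p x + i)) j := by
  have h := apply_blockStart_add hp hκ hx hj
  have hpos := (hp.pos_iff_le_supportEnd hκ).2 hx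
  unfold blockwise
  rw [h, if_pos hpos]
  change φ (blockLength p x) (fun i => y (blockStart p x + i)) (blockStart p x + j - blockStart p x)
    = _
  rw [Nat.add_sub_cancel_left]

theorem blockwise_eq {x : ℕ} (hx : x ≤ supportEnd p) (φ : ℕ → (ℕ → ℝ) → ℕ → ℝ) (y : ℕ → ℝ) :
    blockwise φ p y x =
      φ (blockLength p x) (fun i => y (blockStart p x + i)) (x - blockStart p x) := by
  unfold blockwise
  rw [if_pos ((hp.pos_iff_le_supportEnd hκ).2 hx)]
  rfl

/-- The intervals of constancy tile the support; the induction steps to the one that ends just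
before `blockStart p x`. -/
theorem sum_range_blockStart_eq_zero {d : ℕ → ℝ}
    (hd : ∀ x ≤ supportEnd p, ∑ j ∈ Finset.range (blockLength p x), d (blockStart p x + j) = 0)
    (x : ℕ) (hx : x ≤ supportEnd p) : ∑ i ∈ Finset.range (blockStart p x), d i = 0 := by
  induction x using Nat.strong_induction_on with
  | _ x ih =>
  rcases Nat.eq_zero_or_pos (blockStart p x) with h0 | h0
  · simp [h0]
  have h1 := blockStart_le hp hκ hx
  obtain ⟨z, hz⟩ := Nat.exists_eq_succ_of_ne_zero h0.ne'
  rw [Nat.succ_eq_add_one] at hz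
  have hzκ : z ≤ supportEnd p := by omega
  have hend : blockStart p z + blockLength p z = z + 1 := by
    have h2 := lt_blockStart_add hp hκ hzκ
    have h3 := blockStart_le hp hκ hzκ
    by_contra hne
    have h4 : p (z + 1) = p z := (eq_iff_mem_block hp hκ hzκ _).2 ⟨by omega, by omega⟩
    have h5 := apply_blockStart_add hp hκ hx (j := 0)
      (by have := lt_blockStart_add hp hκ hx; omega)
    rw [add_zero, hz, h4] at h5
    have := ((eq_iff_mem_block hp hκ hx z).1 h5).1
    omega
  rw [hz, ← hend, Finset.sum_range_add, ih z (by omega) hzκ, hd z hzκ, add_zero]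

theorem sum_range_blockStart_add {d : ℕ → ℝ}
    (hd : ∀ x ≤ supportEnd p, ∑ j ∈ Finset.range (blockLength p x), d (blockStart p x + j) = 0)
    {x : ℕ} (hx : x ≤ supportEnd p) (j : ℕ) : ∑ i ∈ Finset.range (blockStart p x + j), d i =
      ∑ i ∈ Finset.range j, d (blockStart p x + i) := by
  rw [Finset.sum_range_add, sum_range_blockStart_eq_zero hp hκ hd x hx, zero_add]

theorem sum_range_supportEnd_eq_zero {d : ℕ → ℝ}
    (hd : ∀ x ≤ supportEnd p, ∑ j ∈ Finset.range (blockLength p x), d (blockStart p x + j) = 0) :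
    ∑ i ∈ Finset.range (supportEnd p + 1), d i = 0 := by
  have h1 := lt_blockStart_add hp hκ (le_refl (supportEnd p))
  have h2 := blockStart_add_le hp hκ (le_refl (supportEnd p))
  rw [show supportEnd p + 1 = blockStart p (supportEnd p) + blockLength p (supportEnd p) by omega,
    sum_range_blockStart_add hp hκ hd le_rfl, hd _ le_rfl]

/-! ### Blockwise operators -/

theorem sum_block_le {x : ℕ} (hx : x ≤ supportEnd p) {f : ℕ → ℝ} (hf : ∀ i, 0 ≤ f i) :
    ∑ i ∈ Finset.range (blockLength p x), f (blockStart p x + i) ≤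
      ∑ i ∈ Finset.range (supportEnd p + 1), f i := by
  have h := blockStart_add_le hp hκ hx
  calc ∑ i ∈ Finset.range (blockLength p x), f (blockStart p x + i)
      ≤ ∑ i ∈ Finset.range (blockStart p x), f i +
        ∑ i ∈ Finset.range (blockLength p x), f (blockStart p x + i) :=
        le_add_of_nonneg_left (Finset.sum_nonneg fun i _ => hf i)
    _ = ∑ i ∈ Finset.range (blockStart p x + blockLength p x), f i :=
        (Finset.sum_range_add _ _ _).symm
    _ ≤ _ := Finset.sum_le_sum_of_subset_of_nonneg (Finset.range_mono h) fun i _ _ => hf i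

theorem abs_blockwise_sub_le {φ : ℕ → (ℕ → ℝ) → ℕ → ℝ} (hφ : IsRegular φ) (y y' : ℕ → ℝ)
    {x : ℕ} (hx : x ≤ supportEnd p) : |blockwise φ p y x - blockwise φ p y' x| ≤
      2 * ∑ i ∈ Finset.range (supportEnd p + 1), |y i - y' i| := by
  rw [blockwise_eq hp hκ hx, blockwise_eq hp hκ hx]
  refine (hφ.lipschitz _ _ _ _).trans ?_
  gcongr
  exact sum_block_le hp hκ hx (f := fun i => |y i - y' i|) fun i => abs_nonneg _

theorem continuous_blockwise {φ : ℕ → (ℕ → ℝ) → ℕ → ℝ} (hφ : IsRegular φ) :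
    Continuous (blockwise φ p) := by
  refine continuous_pi fun x => ?_
  rcases le_or_gt x (supportEnd p) with hx | hx
  · refine continuous_iff_continuousAt.2 fun y => ?_
    refine tendsto_iff_dist_tendsto_zero.2 ?_
    have hlim : Tendsto (fun z : ℕ → ℝ => 2 * ∑ i ∈ Finset.range (supportEnd p + 1), |z i - y i|)
        (𝓝 y) (𝓝 (2 * ∑ i ∈ Finset.range (supportEnd p + 1), |y i - y i|)) :=
      Continuous.tendsto (by fun_prop) y
    simp only [sub_self, abs_zero, Finset.sum_const_zero, mul_zero] at hlim
    exact squeeze_zero (fun _ => dist_nonneg)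
      (fun z => abs_blockwise_sub_le hp hκ hφ z y hx) hlim
  · have : (fun y => blockwise φ p y x) = fun y => y x := by
      funext y
      simp [blockwise, hp.eq_zero_of_supportEnd_lt hκ hx]
    rw [this]
    exact continuous_apply x

theorem blockwise_of_lt (φ : ℕ → (ℕ → ℝ) → ℕ → ℝ) (y : ℕ → ℝ) {x : ℕ} (hx : supportEnd p < x) :
    blockwise φ p y x = y x := by
  simp [blockwise, hp.eq_zero_of_supportEnd_lt hκ hx]

omit hp hκ in
theorem IsRegular.map_zero {φ : ℕ → (ℕ → ℝ) → ℕ → ℝ} (hφ : IsRegular φ) (m x : ℕ) :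
    φ m (fun _ => 0) x = 0 := by
  have := hφ.const_mul m 0 0 le_rfl x
  simpa using this

theorem abs_blockwise_le {φ : ℕ → (ℕ → ℝ) → ℕ → ℝ} (hφ : IsRegular φ) (y : ℕ → ℝ)
    {x : ℕ} (hx : x ≤ supportEnd p) : |blockwise φ p y x| ≤
      2 * ∑ i ∈ Finset.range (supportEnd p + 1), |y i| := by
  have h := abs_blockwise_sub_le hp hκ hφ y (fun _ => 0) hx
  rw [blockwise_eq hp hκ hx φ fun _ => 0, hφ.map_zero] at h
  simpa using h

omit hp hκ in
theorem blockwise_const_mul {φ : ℕ → (ℕ → ℝ) → ℕ → ℝ} (hφ : IsRegular φ) (y : ℕ → ℝ) {c : ℝ}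
    (hc : 0 ≤ c) (x : ℕ) : blockwise φ p (fun i => c * y i) x = c * blockwise φ p y x := by
  unfold blockwise
  split_ifs
  · exact hφ.const_mul _ _ c hc _
  · rfl

theorem blockwise_truncate (y : ℕ → ℝ) : blockwise truncate p y = y := by
  funext x
  rcases le_or_gt x (supportEnd p) with hx | hx
  · have h1 := blockStart_le hp hκ hx
    have h2 := lt_blockStart_add hp hκ hx
    rw [blockwise_eq hp hκ hx]
    simp [truncate, show x - blockStart p x < blockLength p x by omega, Nat.add_sub_cancel' h1]
  · exact blockwise_of_lt hp hκ _ _ hx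

/-! ### Splitting of the operators near `p` -/

omit hp hκ in
/-- Near `p` the operator `φ` acts separately on the intervals of constancy of `p`. -/
def Splits (φ : ℕ → (ℕ → ℝ) → ℕ → ℝ) (p : ℕ → ℝ) : Prop :=
  ∃ δ > 0, ∀ w : ℕ → ℝ, (∀ x ≤ supportEnd p, |w x - p x| ≤ δ) →
    ∀ x ≤ supportEnd p, φ (supportEnd p + 1) w x = p x + blockwise φ p (fun i => w i - p i) x

theorem splits_truncate : Splits truncate p := by
  refine ⟨1, one_pos, fun w _ x hx => ?_⟩
  rw [blockwise_truncate hp hκ]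
  simp [truncate, Nat.lt_succ_of_le hx]

omit hκ in
theorem exists_gap : ∃ η > 0, ∀ i < supportEnd p, p (i + 1) ≠ p i → η ≤ p i - p (i + 1) := by
  set F := (Finset.range (supportEnd p)).filter fun i => p (i + 1) ≠ p i with hF
  rcases F.eq_empty_or_nonempty with he | hne
  · refine ⟨1, one_pos, fun i hi h => ?_⟩
    have : i ∈ F := by simp [hF, hi, h]
    simp [he] at this
  · obtain ⟨a, ha, hmin⟩ := Finset.exists_min_image F (fun i => p i - p (i + 1)) hne
    refine ⟨p a - p (a + 1), ?_, fun i hi h => hmin i (by simp [hF, hi, h])⟩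
    have h1 : p (a + 1) ≠ p a := by simp [hF] at ha; exact ha.2
    have h2 := hp.antitone (Nat.le_succ a)
    exact sub_pos.2 (lt_of_le_of_ne h2 h1)

/-- Inside an interval of constancy the output of `φ` is already decreasing; across a jump of `p` a
small perturbation cannot undo the gap. -/
theorem exists_add_blockwise_succ_le {φ : ℕ → (ℕ → ℝ) → ℕ → ℝ} (hφ : IsRegular φ)
    (hanti : ∀ m w i, i + 1 < m → φ m w (i + 1) ≤ φ m w i) :
    ∃ δ > 0, ∀ y : ℕ → ℝ, (∀ x ≤ supportEnd p, |y x| ≤ δ) → ∀ i < supportEnd p,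
      p (i + 1) + blockwise φ p y (i + 1) ≤ p i + blockwise φ p y i := by
  obtain ⟨η, hη, hgap⟩ := exists_gap hp
  -- The ℓ₁ norm of `y` is then at most `η / 4`, so each blockwise value is at most `η / 2` and two
  -- of them cannot exceed the smallest jump `η`.
  refine ⟨η / (4 * (supportEnd p + 1)), by positivity, fun y hy i hi => ?_⟩
  by_cases he : p (i + 1) = p i
  · have h1 := blockStart_le hp hκ hi.le
    have h2 := ((eq_iff_mem_block hp hκ hi.le _).1 he).2
    obtain ⟨j, hj⟩ := Nat.exists_eq_add_of_le h1
    have e1 := blockwise_blockStart_add hp hκ hi.le (j := j) (by omega) φ y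
    have e2 := blockwise_blockStart_add hp hκ hi.le (j := j + 1) (by omega) φ y
    rw [← hj] at e1
    rw [← add_assoc, ← hj] at e2
    rw [he, e1, e2]
    have := hanti (blockLength p i) (fun k => y (blockStart p i + k)) j (by omega)
    linarith
  · have hsum : ∑ k ∈ Finset.range (supportEnd p + 1), |y k| ≤ η / 4 := by
      calc ∑ k ∈ Finset.range (supportEnd p + 1), |y k|
          ≤ ∑ _k ∈ Finset.range (supportEnd p + 1), η / (4 * (supportEnd p + 1)) :=
            Finset.sum_le_sum fun k hk => hy k (by simpa [Nat.lt_succ_iff] using hk)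
        _ = η / 4 := by
            simp only [Finset.sum_const, Finset.card_range, nsmul_eq_mul]
            push_cast
            field_simp
    have b1 := (abs_le.1 (abs_blockwise_le hp hκ hφ y hi.le)).1
    have b2 := (abs_le.1 (abs_blockwise_le hp hκ hφ y (show i + 1 ≤ supportEnd p from hi))).2
    linarith [hgap i hi he]

/-- The blockwise rearrangement, added back to `p`, is globally decreasing and on each interval a
permutation of `w`; uniqueness of the decreasing rearrangement concludes. -/
theorem splits_rear : Splits rear p := by
  obtain ⟨δ, hδ, h⟩ := exists_add_blockwise_succ_le hp hκ isRegular_rear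
    fun m w i hi => (isRear_rear m w).antitone i (i + 1) (Nat.le_succ i) hi
  refine ⟨δ, hδ, fun w hw x hx => ?_⟩
  set y : ℕ → ℝ := fun i => w i - p i with hy
  have hs := h y hw
  refine (IsRear.eq_rear (w := w) (s := fun i => p i + blockwise rear p y i) ⟨?_, ?_⟩
    (Nat.lt_succ_of_le hx)).symm
  · intro i j hij
    induction j, hij using Nat.le_induction with
    | base => exact fun _ => le_rfl
    | succ k hk ih => exact fun hlt => (hs k (by omega)).trans (ih (by omega))
  · intro f
    rw [← sub_eq_zero, ← Finset.sum_sub_distrib]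
    refine sum_range_supportEnd_eq_zero hp hκ fun z hz => ?_
    rw [Finset.sum_sub_distrib, sub_eq_zero]
    have h1 := (isRear_rear (blockLength p z) fun i => y (blockStart p z + i)).sum_comp
      fun t => f (p z + t)
    refine (Finset.sum_congr rfl fun j hj => ?_).trans (h1.trans (Finset.sum_congr rfl fun j hj => ?_))
    · rw [Finset.mem_range] at hj
      rw [blockwise_blockStart_add hp hκ hz hj, apply_blockStart_add hp hκ hz hj]
    · rw [Finset.mem_range] at hj
      simp only [hy]
      rw [apply_blockStart_add hp hκ hz hj, add_sub_cancel]

/-- The candidate is checked against the characterization `IsGren`. Its partial sums agree with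
those of `w` at the ends of the intervals of constancy, and inside an interval they exceed them by
exactly the local gap between majorant and sums. Majorization and the flat-or-touch alternative are
thus inherited from each interval. -/
theorem splits_gren : Splits gren p := by
  obtain ⟨δ, hδ, h⟩ := exists_add_blockwise_succ_le hp hκ isRegular_gren
    fun m w i hi => (isGren_gren m w).succ_le i hi
  refine ⟨δ, hδ, fun w hw x hx => ?_⟩
  set y : ℕ → ℝ := fun i => w i - p i with hy
  set s : ℕ → ℝ := fun i => p i + blockwise gren p y i with hsdef
  have hs := h y hw
  have hG : ∀ z, IsGren (blockLength p z) (fun i => y (blockStart p z + i))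
      (gren (blockLength p z) fun i => y (blockStart p z + i)) := fun z => isGren_gren _ _
  have hterm : ∀ z ≤ supportEnd p, ∀ j < blockLength p z,
      s (blockStart p z + j) - w (blockStart p z + j) =
        gren (blockLength p z) (fun i => y (blockStart p z + i)) j - y (blockStart p z + j) := by
    intro z hz j hj
    simp only [hsdef, hy]
    rw [blockwise_blockStart_add hp hκ hz hj]
    ring
  have hpart : ∀ z ≤ supportEnd p, ∀ k ≤ blockLength p z,
      ∑ j ∈ Finset.range k, (s (blockStart p z + j) - w (blockStart p z + j)) =
        ∑ j ∈ Finset.range k, gren (blockLength p z) (fun i => y (blockStart p z + i)) j -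
          ∑ j ∈ Finset.range k, y (blockStart p z + j) := by
    intro z hz k hk
    rw [← Finset.sum_sub_distrib]
    exact Finset.sum_congr rfl fun j hj => hterm z hz j ((Finset.mem_range.1 hj).trans_le hk)
  have hzero : ∀ z ≤ supportEnd p, ∑ j ∈ Finset.range (blockLength p z),
      (s (blockStart p z + j) - w (blockStart p z + j)) = 0 := by
    intro z hz
    rw [hpart z hz _ le_rfl, (hG z).sum_eq, sub_self]
  have hall := sum_range_supportEnd_eq_zero (d := fun i => s i - w i) hp hκ hzero
  have hdiff : ∀ z ≤ supportEnd p, ∀ k ≤ blockLength p z,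
      ∑ i ∈ Finset.range (blockStart p z + k), s i - ∑ i ∈ Finset.range (blockStart p z + k), w i =
        ∑ j ∈ Finset.range k, gren (blockLength p z) (fun i => y (blockStart p z + i)) j -
          ∑ j ∈ Finset.range k, y (blockStart p z + j) := by
    intro z hz k hk
    rw [← hpart z hz k hk, ← Finset.sum_sub_distrib]
    exact sum_range_blockStart_add (d := fun i => s i - w i) hp hκ hzero hz k
  rw [Finset.sum_sub_distrib, sub_eq_zero] at hall
  refine (IsGren.eq_gren (w := w) (s := s) ⟨fun i hi => hs i (by omega), ?_, hall, ?_⟩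
    (Nat.lt_succ_of_le hx)).symm
  · intro j hj
    rcases Nat.lt_or_ge (supportEnd p) j with hlt | hle
    · rw [show j = supportEnd p + 1 by omega, hall]
    · obtain ⟨k, hk⟩ := Nat.exists_eq_add_of_le (blockStart_le hp hκ hle)
      have hk' := lt_blockStart_add hp hκ hle
      have h1 := hdiff j hle k (by omega)
      rw [← hk] at h1
      have h2 := (hG j).sum_le k (by omega)
      linarith
  · intro j hj
    have hj1 : j + 1 ≤ supportEnd p := by omega
    have hjκ : j ≤ supportEnd p := by omega
    obtain ⟨k, hk⟩ := Nat.exists_eq_add_of_le (blockStart_le hp hκ hjκ)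
    have hk' := lt_blockStart_add hp hκ hjκ
    by_cases he : p (j + 1) = p j
    · have h2 := ((eq_iff_mem_block hp hκ hjκ _).1 he).2
      refine ((hG j).flat_or_touch k (by omega)).imp (fun e => ?_) fun e => ?_
      · have e1 := blockwise_blockStart_add hp hκ hjκ (j := k) (by omega) gren y
        have e2 := blockwise_blockStart_add hp hκ hjκ (j := k + 1) (by omega) gren y
        rw [← hk] at e1
        rw [← add_assoc, ← hk] at e2
        simp only [hsdef]
        rw [he, e1, e2, e]
      · have h1 := hdiff j hjκ (k + 1) (by omega)
        rw [← add_assoc, ← hk, e, sub_self, sub_eq_zero] at h1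
        exact h1
    -- At a jump of `p`, `j + 1` is the end of an interval of constancy, where the sums touch.
    · right
      have h1 := hdiff j hjκ (blockLength p j) le_rfl
      have h3 : blockStart p j + blockLength p j = j + 1 := by
        by_contra hne
        exact he ((eq_iff_mem_block hp hκ hjκ _).2 ⟨by omega, by omega⟩)
      rw [(hG j).sum_eq, sub_self, sub_eq_zero, h3] at h1
      exact h1

end Blocks

/-! ### Finitely supported sequences in `ℓ_k` -/

section Ell

variable (k : ℝ≥0∞) [hk : Fact (1 ≤ k)]

theorem memℓp_of_eq_zero {m : ℕ} {w : ℕ → ℝ} (hw : ∀ x, m ≤ x → w x = 0) : Memℓp w k := by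
  refine (memℓp_zero ((Set.finite_lt_nat m).subset fun x hx => ?_)).of_exponent_ge zero_le
  by_contra h
  exact hx (hw x (not_lt.1 h))

/-- For sequences supported on a fixed finite set, coordinatewise convergence upgrades to
convergence in every ℓ_k through this finite sum, which is continuous in the product topology. -/
theorem toEll_eq_sum {m : ℕ} {w : ℕ → ℝ} (hw : ∀ x, m ≤ x → w x = 0) :
    toEll k w = ∑ x ∈ Finset.range m, lp.single k x (w x) := by
  unfold toEll
  rw [dif_pos (memℓp_of_eq_zero k hw)]
  ext x
  simp only [lp.coeFn_sum, Finset.sum_apply, lp.coeFn_single, Finset.sum_pi_single]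
  split_ifs with h
  · rfl
  · exact hw x (by simpa using h)

theorem continuous_sum_single (m : ℕ) :
    Continuous fun w : ℕ → ℝ => ∑ x ∈ Finset.range m, (lp.single k x (w x) : Ell k) := by
  have hk0 : 0 < k := zero_lt_one.trans_le hk.out
  refine continuous_finsetSum _ fun x _ => ?_
  have h1 : Continuous fun a : ℝ => (lp.single k x a : Ell k) := by
    refine (AddMonoidHomClass.isometry_of_norm
      (lp.singleAddMonoidHom (E := fun _ : ℕ => ℝ) k x) fun a => ?_).continuous
    exact lp.norm_single (E := fun _ : ℕ => ℝ) hk0 x a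
  exact h1.comp (continuous_apply x)

theorem norm_toEll_le {m : ℕ} {w : ℕ → ℝ} (hw : ∀ x, m ≤ x → w x = 0) :
    ‖toEll k w‖ ≤ ∑ x ∈ Finset.range m, |w x| := by
  have hk0 : 0 < k := zero_lt_one.trans_le hk.out
  rw [toEll_eq_sum k hw]
  refine (norm_sum_le _ _).trans (Finset.sum_le_sum fun x _ => ?_)
  rw [lp.norm_single hk0, Real.norm_eq_abs]

end Ell

/-! ### The terms of the Hellinger distance -/

/-- One term `|√a - √b|²` of the Hellinger distance. -/
noncomputable def hellingerTerm (a b : ℝ) : ℝ := ‖(a : ℂ) ^ (1 / 2 : ℂ) - (b : ℂ) ^ (1 / 2 : ℂ)‖ ^ 2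

theorem hellingerTerm_of_nonneg {a b : ℝ} (ha : 0 ≤ a) (hb : 0 ≤ b) :
    hellingerTerm a b = (√a - √b) ^ 2 := by
  have key : ∀ t : ℝ, 0 ≤ t → (t : ℂ) ^ (1 / 2 : ℂ) = ((√t : ℝ) : ℂ) := by
    intro t ht
    rw [Real.sqrt_eq_rpow, Complex.ofReal_cpow ht]
    norm_num
  rw [hellingerTerm, key _ ha, key _ hb, ← Complex.ofReal_sub, Complex.norm_real,
    Real.norm_eq_abs, sq_abs]

theorem norm_cpow_half_sq (a : ℝ) : ‖(a : ℂ) ^ (1 / 2 : ℂ)‖ ^ 2 = |a| := by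
  have h : (1 / 2 : ℂ) = ((1 / 2 : ℝ) : ℂ) := by norm_num
  rw [h, Complex.norm_cpow_real, ← Real.sqrt_eq_rpow, Real.sq_sqrt (norm_nonneg _),
    Complex.norm_real, Real.norm_eq_abs]

theorem hellingerTerm_zero_right (a : ℝ) : hellingerTerm a 0 = |a| := by
  rw [hellingerTerm, Complex.ofReal_zero, Complex.zero_cpow (by norm_num), sub_zero,
    norm_cpow_half_sq]

/-- For a ≥ 0, |√a - √b| = |a - b| / (√a + √b) ≤ |a - b| / √b. For a < 0 the term is at most 2(|a| +
b) = 2(b - a), and b - a ≥ b. -/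
theorem hellingerTerm_le {a b : ℝ} (hb : 0 < b) : hellingerTerm a b ≤ 2 * ((a - b) ^ 2 / b) := by
  rcases le_or_gt 0 a with ha | ha
  · rw [hellingerTerm_of_nonneg ha hb.le]
    have h1 : (a - b) ^ 2 = (√a - √b) ^ 2 * (√a + √b) ^ 2 := by
      rw [← mul_pow]
      congr 1
      nlinarith [Real.mul_self_sqrt ha, Real.mul_self_sqrt hb.le]
    have h2 : b ≤ (√a + √b) ^ 2 := by
      nlinarith [Real.mul_self_sqrt hb.le, Real.sqrt_nonneg a, Real.sqrt_nonneg b,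
        mul_nonneg (Real.sqrt_nonneg a) (Real.sqrt_nonneg b)]
    have h3 : (√a - √b) ^ 2 ≤ (a - b) ^ 2 / b := by
      rw [le_div_iff₀ hb, h1]
      exact mul_le_mul_of_nonneg_left h2 (sq_nonneg _)
    have h4 : 0 ≤ (a - b) ^ 2 / b := by positivity
    linarith
  · have h1 : hellingerTerm a b ≤ 2 * (|a| + |b|) := by
      have h2 := norm_sub_le ((a : ℂ) ^ (1 / 2 : ℂ)) ((b : ℂ) ^ (1 / 2 : ℂ))
      have h3 := norm_cpow_half_sq a
      have h4 := norm_cpow_half_sq b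
      have h5 := norm_nonneg ((a : ℂ) ^ (1 / 2 : ℂ) - (b : ℂ) ^ (1 / 2 : ℂ))
      rw [hellingerTerm, ← h3, ← h4]
      nlinarith [sq_nonneg (‖(a : ℂ) ^ (1 / 2 : ℂ)‖ - ‖(b : ℂ) ^ (1 / 2 : ℂ)‖)]
    refine h1.trans ?_
    rw [abs_of_neg ha, abs_of_pos hb]
    gcongr
    rw [le_div_iff₀ hb]
    nlinarith

section HellingerLimit

variable {ι : Type*} {l : Filter ι} {N : ι → ℕ} {a z : ι → ℝ} {q z₀ : ℝ}

/-- Delta method: the term equals ½ (z / (√a + √q))² once `a` is positive, and √a + √q → 2√q. -/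
theorem tendsto_mul_hellingerTerm_of_pos (hq : 0 < q) (hN : Tendsto N l atTop)
    (hz : Tendsto z l (𝓝 z₀)) (hza : ∀ i, z i = √(N i : ℝ) * (a i - q)) :
    Tendsto (fun i => (N i : ℝ) * (2⁻¹ * hellingerTerm (a i) q)) l (𝓝 (8⁻¹ * (z₀ ^ 2 / q))) := by
  have hNr : Tendsto (fun i => √(N i : ℝ)) l atTop :=
    Real.tendsto_sqrt_atTop.comp (tendsto_natCast_atTop_atTop.comp hN)
  have hNpos : ∀ᶠ i in l, 0 < √(N i : ℝ) := hNr.eventually_gt_atTop 0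
  have ha : Tendsto a l (𝓝 q) := by
    have h1 : Tendsto (fun i => q + z i / √(N i : ℝ)) l (𝓝 (q + 0)) :=
      tendsto_const_nhds.add (hz.div_atTop hNr)
    rw [add_zero] at h1
    refine h1.congr' ?_
    filter_upwards [hNpos] with i hi
    rw [hza]
    field_simp
    ring
  have hapos : ∀ᶠ i in l, 0 < a i := ha.eventually (lt_mem_nhds hq)
  have hsq : 0 < √q := Real.sqrt_pos.2 hq
  have h2 : Tendsto (fun i => 2⁻¹ * (z i / (√(a i) + √q)) ^ 2) l
      (𝓝 (2⁻¹ * (z₀ / (√q + √q)) ^ 2)) := by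
    refine ((hz.div ?_ (by positivity)).pow 2).const_mul _
    exact ((Real.continuous_sqrt.tendsto q).comp ha).add tendsto_const_nhds
  have he : 2⁻¹ * (z₀ / (√q + √q)) ^ 2 = 8⁻¹ * (z₀ ^ 2 / q) := by
    have : (√q + √q) ^ 2 = 4 * q := by nlinarith [Real.mul_self_sqrt hq.le]
    rw [div_pow, this]
    field_simp
    ring
  rw [he] at h2
  refine h2.congr' ?_
  filter_upwards [hapos, hNpos] with i hai hNi
  rw [hellingerTerm_of_nonneg hai.le hq.le, hza]
  have h3 : a i - q = (√(a i) - √q) * (√(a i) + √q) := by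
    nlinarith [Real.mul_self_sqrt hai.le, Real.mul_self_sqrt hq.le]
  have h4 : √(a i) + √q ≠ 0 := by positivity
  have h5 : (N i : ℝ) = √(N i : ℝ) ^ 2 := (Real.sq_sqrt (Nat.cast_nonneg _)).symm
  rw [h3, ← mul_assoc, mul_div_assoc, div_self h4, mul_one, mul_pow, ← h5]
  ring

/-- At `q = 0` the term is `|a|`, so the statistic is √N |z| / 2. -/
theorem tendsto_mul_hellingerTerm_zero (hN : Tendsto N l atTop) (hz : Tendsto z l (𝓝 z₀))
    (hza : ∀ i, z i = √(N i : ℝ) * a i) (h0 : z₀ ≠ 0) :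
    Tendsto (fun i => (N i : ℝ) * (2⁻¹ * hellingerTerm (a i) 0)) l atTop := by
  have hNr : Tendsto (fun i => √(N i : ℝ)) l atTop :=
    Real.tendsto_sqrt_atTop.comp (tendsto_natCast_atTop_atTop.comp hN)
  have h1 : Tendsto (fun i => √(N i : ℝ) * (2⁻¹ * |z i|)) l atTop :=
    hNr.atTop_mul_pos (by positivity : 0 < 2⁻¹ * |z₀|) (hz.abs.const_mul _)
  refine h1.congr fun i => ?_
  rw [hellingerTerm_zero_right, hza, abs_mul, abs_of_nonneg (Real.sqrt_nonneg _)]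
  have h5 : √(N i : ℝ) * √(N i : ℝ) = N i := Real.mul_self_sqrt (Nat.cast_nonneg _)
  calc √(N i : ℝ) * (2⁻¹ * (√(N i : ℝ) * |a i|))
      = (√(N i : ℝ) * √(N i : ℝ)) * (2⁻¹ * |a i|) := by ring
    _ = _ := by rw [h5]

/-- The limit of one term of the Hellinger statistic. -/
theorem tendsto_mul_ofReal_hellingerTerm (hq : 0 ≤ q) (hN : Tendsto N l atTop)
    (hz : Tendsto z l (𝓝 z₀)) (hza : ∀ i, z i = √(N i : ℝ) * (a i - q))
    (h0 : q = 0 → z₀ ≠ 0 ∨ ∀ᶠ i in l, z i = 0) :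
    Tendsto (fun i => (N i : ℝ≥0∞) * (2⁻¹ * ENNReal.ofReal (hellingerTerm (a i) q))) l
      (𝓝 (8⁻¹ * (ENNReal.ofReal (z₀ ^ 2) / ENNReal.ofReal q))) := by
  have hcast : ∀ i, (N i : ℝ≥0∞) * (2⁻¹ * ENNReal.ofReal (hellingerTerm (a i) q)) =
      ENNReal.ofReal ((N i : ℝ) * (2⁻¹ * hellingerTerm (a i) q)) := by
    intro i
    rw [ENNReal.ofReal_mul (Nat.cast_nonneg _), ENNReal.ofReal_mul (by norm_num),
      ENNReal.ofReal_natCast, ENNReal.ofReal_inv_of_pos (by norm_num), ENNReal.ofReal_ofNat]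
  simp only [hcast]
  rcases hq.eq_or_lt with rfl | hq
  · by_cases hz0 : z₀ = 0
    -- The form 0/0: convergence of `z` to 0 says nothing about √N |z|, so `z` has to vanish
    -- exactly.
    · have hev := (h0 rfl).resolve_left (by simpa using hz0)
      subst hz0
      simp only [ne_eq, OfNat.ofNat_ne_zero, not_false_eq_true, zero_pow, ENNReal.ofReal_zero,
        ENNReal.zero_div, mul_zero]
      refine tendsto_const_nhds.congr' ?_
      filter_upwards [hev, hN.eventually_ge_atTop 1] with i hi hNi
      have hpos : 0 < √(N i : ℝ) := Real.sqrt_pos.2 (by exact_mod_cast hNi)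
      have hai : a i = 0 := by
        have := hza i
        rw [hi, sub_zero, eq_comm, mul_eq_zero] at this
        exact this.resolve_left hpos.ne'
      rw [hai, hellingerTerm_zero_right]
      simp
    · have htop : (8 : ℝ≥0∞)⁻¹ * (ENNReal.ofReal (z₀ ^ 2) / ENNReal.ofReal 0) = ⊤ := by
        rw [ENNReal.ofReal_zero, ENNReal.div_zero, ENNReal.mul_top (by simp)]
        simp only [ne_eq, ENNReal.ofReal_eq_zero, not_le]
        positivity
      rw [htop]
      refine ENNReal.tendsto_ofReal_atTop.comp ?_
      exact tendsto_mul_hellingerTerm_zero hN hz (by simpa using hza) hz0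
  · have he : (8 : ℝ≥0∞)⁻¹ * (ENNReal.ofReal (z₀ ^ 2) / ENNReal.ofReal q) =
        ENNReal.ofReal (8⁻¹ * (z₀ ^ 2 / q)) := by
      rw [ENNReal.ofReal_mul (by norm_num), ENNReal.ofReal_div_of_pos hq,
        ENNReal.ofReal_inv_of_pos (by norm_num), ENNReal.ofReal_ofNat]
    rw [he]
    exact ENNReal.tendsto_ofReal (tendsto_mul_hellingerTerm_of_pos hq hN hz hza)

end HellingerLimit

theorem mul_hellingerSq_eq (n : ℕ) {m : ℕ} {a b : ℕ → ℝ} (ha : ∀ x, m ≤ x → a x = 0)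
    (hb : ∀ x, m ≤ x → b x = 0) : (n : ℝ≥0∞) * hellingerSq a b =
      ∑ x ∈ Finset.range m, (n : ℝ≥0∞) * (2⁻¹ * ENNReal.ofReal (hellingerTerm (a x) (b x))) := by
  unfold hellingerSq
  rw [tsum_eq_sum (s := Finset.range m), Finset.mul_sum, Finset.mul_sum]
  · rfl
  · intro x hx
    have hx' : m ≤ x := by simpa using hx
    rw [ha x hx', hb x hx']
    simp

/-! ### Mixing sequences -/

theorem continuous_mixing : Continuous mixing := by
  refine continuous_pi fun x => ?_
  unfold mixing
  fun_prop

theorem mixing_eq_zero_of_lt {w : ℕ → ℝ} {m : ℕ} (hw : ∀ x, m ≤ x → w x = 0) (x : ℕ) (hx : m ≤ x) :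
    mixing w x = 0 := by
  simp [mixing, hw x hx, hw (x + 1) (by omega)]

theorem mixing_eq_zero_iff {w : ℕ → ℝ} {x : ℕ} : mixing w x = 0 ↔ w (x + 1) = w x := by
  have : ((x : ℝ) + 1) ≠ 0 := by positivity
  rw [mixing, mul_eq_zero, neg_eq_zero, or_iff_right this, sub_eq_zero]

theorem mixingFluctuation_eq {Ω : Type*} (p : ℕ → ℝ) (phat : ℕ → Ω → ℕ → ℝ) (n : ℕ) (ω : Ω) :
    mixingFluctuation p phat n ω = mixing fun x => √(n : ℝ) * (phat n ω x - p x) := by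
  funext x
  simp only [mixingFluctuation, mixing]
  ring

theorem abs_mixing_le {w : ℕ → ℝ} {B : ℝ} (hw : ∀ x, |w x| ≤ B) (x : ℕ) :
    |mixing w x| ≤ 2 * ((x : ℝ) + 1) * B := by
  have h1 : |w (x + 1) - w x| ≤ 2 * B := by
    have h2 := abs_le.1 (hw x)
    have h3 := abs_le.1 (hw (x + 1))
    rw [abs_le]
    constructor <;> linarith [h2.1, h2.2, h3.1, h3.2]
  have h0 : (0 : ℝ) ≤ (x : ℝ) + 1 := by positivity
  rw [mixing, abs_mul, abs_neg, abs_of_nonneg h0]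
  nlinarith

/-! ### Estimators -/

section Estimator

variable {Ω : Type*}

/-- The estimator obtained by applying `φ` to the vector of empirical frequencies. -/
noncomputable def estimator (φ : ℕ → (ℕ → ℝ) → ℕ → ℝ) (X : ℕ → Ω → ℕ) (n : ℕ) (ω : Ω) : ℕ → ℝ :=
  φ (sampleLength X n ω) (empirical X n ω)

/-- Samples in the support of `p`. -/
def supportedSamples (p : ℕ → ℝ) (X : ℕ → Ω → ℕ) : Set Ω := {ω | ∀ i, X i ω ≤ supportEnd p}

variable {p : ℕ → ℝ} {X : ℕ → Ω → ℕ} {φ : ℕ → (ℕ → ℝ) → ℕ → ℝ} {n : ℕ} {ω : Ω}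

theorem empirical_eq_zero_of_sampleLength_le {x : ℕ} (hx : sampleLength X n ω ≤ x) :
    empirical X n ω x = 0 := by
  refine empirical_eq_zero fun i hi => ?_
  have : X i ω ≤ (Finset.range n).sup fun i => X i ω :=
    Finset.le_sup (f := fun i => X i ω) (Finset.mem_range.2 hi)
  unfold sampleLength at hx
  omega

theorem estimator_truncate (X : ℕ → Ω → ℕ) : estimator truncate X = empirical X := by
  funext n ω x
  simp only [estimator, truncate]
  split_ifs with h
  · rfl
  · exact (empirical_eq_zero_of_sampleLength_le (not_lt.1 h)).symm

theorem sampleLength_le (hω : ω ∈ supportedSamples p X) :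
    sampleLength X n ω ≤ supportEnd p + 1 := by
  have : (Finset.range n).sup (fun i => X i ω) ≤ supportEnd p := Finset.sup_le fun i _ => hω i
  unfold sampleLength
  omega

theorem empirical_le_one (x : ℕ) : empirical X n ω x ≤ 1 := by
  unfold empirical
  have h1 : ∑ i ∈ Finset.range n, (if X i ω = x then (1 : ℝ) else 0) ≤ n := by
    calc ∑ i ∈ Finset.range n, (if X i ω = x then (1 : ℝ) else 0)
        ≤ ∑ _i ∈ Finset.range n, (1 : ℝ) := Finset.sum_le_sum fun i _ => by split_ifs <;> norm_num
      _ = n := by simp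
  rcases Nat.eq_zero_or_pos n with rfl | hn
  · simp
  have h0 : (0 : ℝ) < n := by exact_mod_cast hn
  rw [inv_mul_le_iff₀ h0]
  simpa using h1

/-- The estimator depends on finitely many ℕ-valued observations, and every function on a countable
discrete space is measurable. No measurability of `φ` or `F` is needed. -/
theorem measurable_comp_estimator {S : Type*} [MeasurableSpace Ω] [MeasurableSpace S]
    (hX : ∀ i, Measurable (X i)) (φ : ℕ → (ℕ → ℝ) → ℕ → ℝ) (n : ℕ) (F : (ℕ → ℝ) → S) :
    Measurable fun ω => F (estimator φ X n ω) := by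
  let G : (Fin n → ℕ) → S := fun a => F (φ ((Finset.univ : Finset (Fin n)).sup a + 1)
    fun x => (n : ℝ)⁻¹ * ∑ i : Fin n, if a i = x then (1 : ℝ) else 0)
  have hG : (fun ω => F (estimator φ X n ω)) = fun ω => G fun i : Fin n => X i ω := by
    funext ω
    have h1 : sampleLength X n ω = (Finset.univ : Finset (Fin n)).sup (fun i => X i ω) + 1 := by
      unfold sampleLength
      congr 1
      refine le_antisymm (Finset.sup_le fun i hi => ?_) (Finset.sup_le fun i _ => ?_)
      · exact Finset.le_sup (f := fun i : Fin n => X i ω)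
          (Finset.mem_univ (⟨i, Finset.mem_range.1 hi⟩ : Fin n))
      · exact Finset.le_sup (f := fun i => X i ω) (Finset.mem_range.2 i.2)
    have h2 : empirical X n ω =
        fun x => (n : ℝ)⁻¹ * ∑ i : Fin n, if X i ω = x then (1 : ℝ) else 0 := by
      funext x
      rw [empirical, Fin.sum_univ_eq_sum_range fun i => if X i ω = x then (1 : ℝ) else 0]
    simp only [G, estimator, h1, h2]
  rw [hG]
  exact (measurable_of_countable G).comp (measurable_pi_iff.2 fun i => hX i)

variable (hp : IsDecreasingPMF p) (hκ : BddAbove {x | 0 < p x})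

include hp hκ

theorem estimator_eq_zero (hφ : IsRegular φ) (hω : ω ∈ supportedSamples p X) {x : ℕ}
    (hx : supportEnd p + 1 ≤ x) : estimator φ X n ω x = 0 :=
  hφ.eq_zero_of_le _ _ _ ((sampleLength_le hω).trans hx)

theorem empiricalFluctuation_eq_zero (hω : ω ∈ supportedSamples p X) {x : ℕ}
    (hx : supportEnd p < x) : empiricalFluctuation p X n ω x = 0 := by
  rw [empiricalFluctuation, empirical_eq_zero_of_sampleLength_le ((sampleLength_le hω).trans hx),
    hp.eq_zero_of_supportEnd_lt hκ hx]
  simp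

/-- Close to `p` the fluctuation of the estimator is a function of the empirical process. -/
theorem exists_estimator_fluctuation_eq (hφ : IsRegular φ) (hs : Splits φ p) (X : ℕ → Ω → ℕ) :
    ∃ δ > 0, ∀ n : ℕ, ∀ ω ∈ supportedSamples p X,
      (∀ x ≤ supportEnd p, |empirical X n ω x - p x| ≤ δ) →
      (fun x => √(n : ℝ) * (estimator φ X n ω x - p x)) =
        blockwise φ p (empiricalFluctuation p X n ω) := by
  obtain ⟨δ, hδ, h⟩ := hs
  have hpos := (hp.pos_iff_le_supportEnd hκ).2 (le_refl (supportEnd p))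
  -- The second bound forces a positive frequency at the end point of the support, so that the
  -- vector of frequencies has full length.
  refine ⟨min δ (p (supportEnd p) / 2), by positivity, fun n ω hω hclose => ?_⟩
  have hlen : sampleLength X n ω = supportEnd p + 1 := by
    refine le_antisymm (sampleLength_le hω) (not_lt.1 fun hlt => ?_)
    have h1 := hclose (supportEnd p) le_rfl
    rw [empirical_eq_zero_of_sampleLength_le (by omega), zero_sub, abs_neg, abs_of_pos hpos] at h1
    have := h1.trans (min_le_right _ _)
    linarith
  funext x
  rcases le_or_gt x (supportEnd p) with hx | hx
  · rw [estimator, hlen, h _ (fun z hz => (hclose z hz).trans (min_le_left _ _)) x hx,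
      add_sub_cancel_left, ← blockwise_const_mul hφ _ (Real.sqrt_nonneg _)]
    rfl
  · rw [estimator_eq_zero hp hκ hφ hω hx, blockwise_of_lt hp hκ _ _ hx,
      empiricalFluctuation_eq_zero hp hκ hω hx, hp.eq_zero_of_supportEnd_lt hκ hx]
    simp

/-- Along the filter the fluctuation converges while √n → ∞, so the empirical frequencies converge
to `p` on the support. -/
theorem eventually_estimator_fluctuation_eq (hφ : IsRegular φ) (hs : Splits φ p) (X : ℕ → Ω → ℕ)
    (y : ℕ → ℝ) : ∀ᶠ r in nearFilter (empiricalFluctuation p X) (supportedSamples p X) y,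
      (fun x => √(r.1 : ℝ) * (estimator φ X r.1 r.2 x - p x)) =
        blockwise φ p (empiricalFluctuation p X r.1 r.2) := by
  obtain ⟨δ, hδ, h⟩ := exists_estimator_fluctuation_eq hp hκ hφ hs X
  set l := nearFilter (empiricalFluctuation p X) (supportedSamples p X) y
  have hN : Tendsto (fun r : ℕ × Ω => √(r.1 : ℝ)) l atTop :=
    Real.tendsto_sqrt_atTop.comp (tendsto_natCast_atTop_atTop.comp (tendsto_fst_nearFilter _ _ _))
  have hclose : ∀ x, ∀ᶠ r in l, |empirical X r.1 r.2 x - p x| ≤ δ := by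
    intro x
    have h1 : Tendsto (fun r : ℕ × Ω => empiricalFluctuation p X r.1 r.2 x) l (𝓝 (y x)) :=
      tendsto_pi_nhds.1 (tendsto_nearFilter (empiricalFluctuation p X) (supportedSamples p X) y) x
    have h2 := (h1.div_atTop hN).abs
    rw [abs_zero] at h2
    filter_upwards [h2.eventually (ge_mem_nhds hδ), hN.eventually_gt_atTop 0] with r hr hr0
    rwa [empiricalFluctuation, mul_div_cancel_left₀ _ hr0.ne'] at hr
  have hall : ∀ᶠ r in l, ∀ x ∈ Finset.range (supportEnd p + 1),
      |empirical X r.1 r.2 x - p x| ≤ δ := (eventually_all_finset _).2 fun x _ => hclose x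
  filter_upwards [hall, eventually_mem_nearFilter (empiricalFluctuation p X) (supportedSamples p X) y]
    with r hr hr2
  exact h r.1 r.2 hr2 fun x hx => hr x (by simpa [Nat.lt_succ_iff] using hx)

/-- Close to `p` the exact blockwise formula gives the bound with constant 2. Otherwise the
empirical process is at least √n δ, while the estimator differs from `p` by at most a constant. -/
theorem exists_estimator_fluctuation_le (hφ : IsRegular φ) (hs : Splits φ p) (X : ℕ → Ω → ℕ) :
    ∃ C : ℝ, 0 ≤ C ∧ ∀ n : ℕ, ∀ ω ∈ supportedSamples p X, ∀ x,
      |√(n : ℝ) * (estimator φ X n ω x - p x)| ≤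
        C * ∑ x ∈ Finset.range (supportEnd p + 1), |empiricalFluctuation p X n ω x| := by
  obtain ⟨δ, hδ, h⟩ := exists_estimator_fluctuation_eq hp hκ hφ hs X
  refine ⟨max 2 ((2 * (supportEnd p + 1) + 1) / δ), by positivity, fun n ω hω x => ?_⟩
  set Λ := ∑ x ∈ Finset.range (supportEnd p + 1), |empiricalFluctuation p X n ω x| with hΛ
  have hΛ0 : 0 ≤ Λ := Finset.sum_nonneg fun _ _ => abs_nonneg _
  rcases le_or_gt x (supportEnd p) with hx | hx
  swap
  · rw [estimator_eq_zero hp hκ hφ hω hx, hp.eq_zero_of_supportEnd_lt hκ hx, sub_zero, mul_zero,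
      abs_zero]
    positivity
  by_cases hclose : ∀ x ≤ supportEnd p, |empirical X n ω x - p x| ≤ δ
  · have h1 := congrFun (h n ω hω hclose) x
    rw [h1]
    refine (abs_blockwise_le hp hκ hφ _ hx).trans ?_
    exact mul_le_mul_of_nonneg_right (le_max_left _ _) hΛ0
  · push Not at hclose
    obtain ⟨z, hz, hzδ⟩ := hclose
    have h1 : √(n : ℝ) * δ ≤ Λ := by
      refine le_trans ?_ (abs_le_sum_range (empiricalFluctuation p X n ω) (Nat.lt_succ_of_le hz))
      rw [empiricalFluctuation, abs_mul, abs_of_nonneg (Real.sqrt_nonneg _)]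
      gcongr
    have h2 : |estimator φ X n ω x - p x| ≤ 2 * (supportEnd p + 1) + 1 := by
      have h3 := hφ.lipschitz (sampleLength X n ω) (empirical X n ω) (fun _ => 0) x
      rw [hφ.map_zero, sub_zero] at h3
      have h4 : ∑ i ∈ Finset.range (sampleLength X n ω), |empirical X n ω i - 0| ≤
          (supportEnd p + 1 : ℝ) := by
        calc ∑ i ∈ Finset.range (sampleLength X n ω), |empirical X n ω i - 0|
            ≤ ∑ _i ∈ Finset.range (sampleLength X n ω), (1 : ℝ) :=
              Finset.sum_le_sum fun i _ => by
                rw [sub_zero, abs_of_nonneg (empirical_nonneg X n ω i)]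
                exact empirical_le_one i
          _ = sampleLength X n ω := by simp
          _ ≤ _ := by exact_mod_cast sampleLength_le hω
      have h5 := abs_le.1 (h3.trans (mul_le_mul_of_nonneg_left h4 (by norm_num)))
      have h6 := hp.nonneg x
      have h7 := hp.le_one x
      rw [estimator, abs_le]
      constructor <;> linarith [h5.1, h5.2]
    rw [abs_mul, abs_of_nonneg (Real.sqrt_nonneg _)]
    calc √(n : ℝ) * |estimator φ X n ω x - p x|
        ≤ √(n : ℝ) * (2 * (supportEnd p + 1) + 1) := by gcongr
      _ = (2 * (supportEnd p + 1) + 1) / δ * (√(n : ℝ) * δ) := by field_simp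
      _ ≤ max 2 ((2 * (supportEnd p + 1) + 1) / δ) * Λ := by
          gcongr
          exact le_max_right _ _

theorem mixingFluctuation_estimator_eq_zero (hφ : IsRegular φ) (hω : ω ∈ supportedSamples p X)
    (x : ℕ) (hx : supportEnd p + 1 ≤ x) : mixingFluctuation p (estimator φ X) n ω x = 0 := by
  rw [mixingFluctuation_eq]
  refine mixing_eq_zero_of_lt (m := supportEnd p + 1) (fun z hz => ?_) x hx
  rw [estimator_eq_zero hp hκ hφ hω hz, hp.eq_zero_of_supportEnd_lt hκ hz, sub_zero, mul_zero]

theorem exists_mixingFluctuation_le (hφ : IsRegular φ) (hs : Splits φ p) (X : ℕ → Ω → ℕ) :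
    ∃ C : ℝ, 0 ≤ C ∧ ∀ n : ℕ, ∀ ω ∈ supportedSamples p X, ∀ x,
      |mixingFluctuation p (estimator φ X) n ω x| ≤
        C * ∑ x ∈ Finset.range (supportEnd p + 1), |empiricalFluctuation p X n ω x| := by
  obtain ⟨C, hC, h⟩ := exists_estimator_fluctuation_le hp hκ hφ hs X
  refine ⟨2 * (supportEnd p + 1) * C, by positivity, fun n ω hω x => ?_⟩
  have hΛ0 : 0 ≤ ∑ x ∈ Finset.range (supportEnd p + 1), |empiricalFluctuation p X n ω x| :=
    Finset.sum_nonneg fun _ _ => abs_nonneg _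
  rcases le_or_gt x (supportEnd p) with hx | hx
  · rw [mixingFluctuation_eq]
    refine (abs_mixing_le (h n ω hω) x).trans ?_
    rw [mul_assoc _ C]
    have : (x : ℝ) ≤ supportEnd p := by exact_mod_cast hx
    gcongr
  · rw [mixingFluctuation_estimator_eq_zero hp hκ hφ hω x hx, abs_zero]
    positivity

theorem tendsto_mixingFluctuation (hφ : IsRegular φ) (hs : Splits φ p) (X : ℕ → Ω → ℕ)
    (y : ℕ → ℝ) : Tendsto (fun r : ℕ × Ω => mixingFluctuation p (estimator φ X) r.1 r.2)
      (nearFilter (empiricalFluctuation p X) (supportedSamples p X) y) (𝓝 (mixing (blockwise φ p y))) := by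
  have h1 : Tendsto (fun r : ℕ × Ω => mixing (blockwise φ p (empiricalFluctuation p X r.1 r.2)))
      (nearFilter (empiricalFluctuation p X) (supportedSamples p X) y) (𝓝 (mixing (blockwise φ p y))) :=
    ((continuous_mixing.comp (continuous_blockwise hp hκ hφ)).tendsto y).comp
      (tendsto_nearFilter _ _ _)
  refine h1.congr' ?_
  filter_upwards [eventually_estimator_fluctuation_eq hp hκ hφ hs X y] with r hr
  rw [mixingFluctuation_eq, hr]

theorem mixing_blockwise_eq_zero {y : ℕ → ℝ} (hy : ∀ x, supportEnd p < x → y x = 0) (x : ℕ)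
    (hx : supportEnd p + 1 ≤ x) : mixing (blockwise φ p y) x = 0 :=
  mixing_eq_zero_of_lt (m := supportEnd p + 1)
    (fun z hz => by rw [blockwise_of_lt hp hκ _ _ hz, hy z hz]) x hx

theorem mixing_nonneg (x : ℕ) : 0 ≤ mixing p x := by
  have h1 := hp.antitone (Nat.le_succ x)
  have h2 : (0 : ℝ) ≤ (x : ℝ) + 1 := by positivity
  rw [mixing, neg_mul, ← mul_neg, neg_sub]
  exact mul_nonneg h2 (sub_nonneg.2 h1)

/-- The Hellinger statistic converges wherever the limit `y` of the empirical process satisfies: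
on each point at which the mixing distribution vanishes, the limit is non-zero or it vanishes
in a neighbourhood of `y`. -/
theorem tendsto_hellinger (hφ : IsRegular φ) (hs : Splits φ p) (X : ℕ → Ω → ℕ) {y : ℕ → ℝ}
    (hy : ∀ x ≤ supportEnd p, mixing p x = 0 → mixing (blockwise φ p y) x ≠ 0 ∨
      ∀ᶠ y' in 𝓝 y, mixing (blockwise φ p y') x = 0) :
    Tendsto (fun r : ℕ × Ω => (r.1 : ℝ≥0∞) * hellingerSq (mixing (estimator φ X r.1 r.2)) (mixing p))
      (nearFilter (empiricalFluctuation p X) (supportedSamples p X) y)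
      (𝓝 (weightedSq p (mixing (blockwise φ p y)))) := by
  set l := nearFilter (empiricalFluctuation p X) (supportedSamples p X) y with hl
  have hz := tendsto_mixingFluctuation hp hκ hφ hs X y
  rw [← hl] at hz
  have hterm : ∀ x ∈ Finset.range (supportEnd p + 1), Tendsto (fun r : ℕ × Ω => (r.1 : ℝ≥0∞) *
      (2⁻¹ * ENNReal.ofReal (hellingerTerm (mixing (estimator φ X r.1 r.2) x) (mixing p x)))) l
      (𝓝 (8⁻¹ * (ENNReal.ofReal (mixing (blockwise φ p y) x ^ 2) /
        ENNReal.ofReal (mixing p x)))) := by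
    intro x hx
    refine tendsto_mul_ofReal_hellingerTerm (mixing_nonneg hp hκ x) (tendsto_fst_nearFilter _ _ _)
      (tendsto_pi_nhds.1 hz x) (fun r => rfl) fun hq => ?_
    refine (hy x (by simpa [Nat.lt_succ_iff] using hx) hq).imp id fun hev => ?_
    filter_upwards [eventually_estimator_fluctuation_eq hp hκ hφ hs X y,
      (tendsto_nearFilter (empiricalFluctuation p X) (supportedSamples p X) y).eventually hev]
      with r hr1 hr2
    rw [mixingFluctuation_eq, hr1, hr2]
  rw [weightedSq, Finset.mul_sum]
  refine (tendsto_finsetSum _ hterm).congr' ?_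
  filter_upwards [eventually_mem_nearFilter (empiricalFluctuation p X) (supportedSamples p X) y]
    with r hr
  refine (mul_hellingerSq_eq r.1 (fun x hx => ?_) fun x hx => ?_).symm
  · exact mixing_eq_zero_of_lt (fun z hz => estimator_eq_zero hp hκ hφ hr hz) x hx
  · exact mixing_eq_zero_of_lt (fun z hz => hp.eq_zero_of_supportEnd_lt hκ hz) x hx

/-- If the mixing distribution is positive on the support, the Hellinger statistic is dominated
by the square of the empirical process. -/
theorem exists_hellinger_le (hφ : IsRegular φ) (hs : Splits φ p) (X : ℕ → Ω → ℕ)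
    (hq : ∀ x ≤ supportEnd p, mixing p x ≠ 0) :
    ∃ C : ℝ, 0 ≤ C ∧ ∀ n : ℕ, ∀ ω ∈ supportedSamples p X,
      (n : ℝ≥0∞) * hellingerSq (mixing (estimator φ X n ω)) (mixing p) ≤
        ENNReal.ofReal
          ((C * ∑ x ∈ Finset.range (supportEnd p + 1), |empiricalFluctuation p X n ω x|) ^ (2 : ℝ)) := by
  obtain ⟨C, hC, h⟩ := exists_mixingFluctuation_le hp hκ hφ hs X
  -- Each term of n H² is at most n(q̂_x - q_x)² / q_x ≤ C² Λ² / q_x. The witness `√A` casts the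
  -- resulting bound `A Λ²` as the power of a multiple of `Λ`.
  set A := ∑ x ∈ Finset.range (supportEnd p + 1), C ^ 2 / mixing p x with hA
  have hqpos : ∀ x ≤ supportEnd p, 0 < mixing p x := fun x hx =>
    lt_of_le_of_ne (mixing_nonneg hp hκ x) (hq x hx).symm
  have hA0 : 0 ≤ A := Finset.sum_nonneg fun x _ =>
    div_nonneg (sq_nonneg _) (mixing_nonneg hp hκ x)
  refine ⟨√A, Real.sqrt_nonneg _, fun n ω hω => ?_⟩
  set Λ := ∑ x ∈ Finset.range (supportEnd p + 1), |empiricalFluctuation p X n ω x| with hΛ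
  have hΛ0 : 0 ≤ Λ := Finset.sum_nonneg fun _ _ => abs_nonneg _
  rw [mul_hellingerSq_eq n
    (mixing_eq_zero_of_lt (fun z hz => estimator_eq_zero hp hκ hφ hω hz))
    (mixing_eq_zero_of_lt (fun z hz => hp.eq_zero_of_supportEnd_lt hκ hz))]
  rw [Real.rpow_two, mul_pow, Real.sq_sqrt hA0, hA, Finset.sum_mul,
    ENNReal.ofReal_sum_of_nonneg fun x _ =>
      mul_nonneg (div_nonneg (sq_nonneg _) (mixing_nonneg hp hκ x)) (sq_nonneg _)]
  refine Finset.sum_le_sum fun x hx => ?_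
  have hq0 := hqpos x (by simpa [Nat.lt_succ_iff] using hx)
  have hcast : (n : ℝ≥0∞) *
      (2⁻¹ * ENNReal.ofReal (hellingerTerm (mixing (estimator φ X n ω) x) (mixing p x))) =
      ENNReal.ofReal ((n : ℝ) *
        (2⁻¹ * hellingerTerm (mixing (estimator φ X n ω) x) (mixing p x))) := by
    rw [ENNReal.ofReal_mul (Nat.cast_nonneg _), ENNReal.ofReal_mul (by norm_num),
      ENNReal.ofReal_natCast, ENNReal.ofReal_inv_of_pos (by norm_num), ENNReal.ofReal_ofNat]
  rw [hcast]
  refine ENNReal.ofReal_le_ofReal ?_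
  have h1 := hellingerTerm_le (a := mixing (estimator φ X n ω) x) hq0
  have h2 : (n : ℝ) * (mixing (estimator φ X n ω) x - mixing p x) ^ 2 ≤ (C * Λ) ^ 2 := by
    have h3 := h n ω hω x
    rw [mixingFluctuation] at h3
    have h4 := sq_le_sq' (abs_le.1 h3).1 (abs_le.1 h3).2
    rwa [mul_pow, Real.sq_sqrt (Nat.cast_nonneg n)] at h4
  calc (n : ℝ) * (2⁻¹ * hellingerTerm (mixing (estimator φ X n ω) x) (mixing p x))
      ≤ n * (2⁻¹ * (2 * ((mixing (estimator φ X n ω) x - mixing p x) ^ 2 / mixing p x))) := by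
        gcongr
    _ = (n * (mixing (estimator φ X n ω) x - mixing p x) ^ 2) / mixing p x := by ring
    _ ≤ (C * Λ) ^ 2 / mixing p x := by gcongr
    _ = _ := by ring

end Estimator

/-! ### The limit theorem for an estimator which splits near `p` -/

section Rate

variable {Ω Ω' : Type*} [MeasurableSpace Ω] [MeasurableSpace Ω']
  {P : Measure Ω} [IsProbabilityMeasure P] {P' : Measure Ω'} [IsProbabilityMeasure P']
  {p : ℕ → ℝ} {X : ℕ → Ω → ℕ} {Y : ℕ → Ω' → ℝ} {φ : ℕ → (ℕ → ℝ) → ℕ → ℝ}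

theorem IsLimitGaussian.ae_eq_zero_of_lt (hY : IsLimitGaussian p Y P') (hp : IsDecreasingPMF p)
    (hκ : BddAbove {x | 0 < p x}) : ∀ᵐ ω ∂P', ∀ x, supportEnd p < x → Y x ω = 0 := by
  refine ae_all_iff.2 fun x => ?_
  by_cases hx : supportEnd p < x
  · filter_upwards [hY.ae_eq_zero (hp.eq_zero_of_supportEnd_lt hκ hx)] with ω hω _ using hω
  · exact ae_of_all _ fun ω h => absurd h hx

/-- Random variables dominated by a power of the empirical process have bounded second moments. -/
theorem exists_lintegral_sq_le (hp : IsDecreasingPMF p) (hκ : BddAbove {x | 0 < p x})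
    (hX : ∀ i, Measurable (X i)) (hindep : iIndepFun X P)
    (hlaw : ∀ i x, P.real {ω | X i ω = x} = p x) {T : ℕ → Ω → ℝ≥0∞} {C s : ℝ} (hC : 0 ≤ C)
    (hs : 0 ≤ s) (hT : ∀ n, ∀ ω ∈ supportedSamples p X, T n ω ≤ ENNReal.ofReal
      ((C * ∑ x ∈ Finset.range (supportEnd p + 1), |empiricalFluctuation p X n ω x|) ^ s)) :
    ∃ B : ℝ≥0∞, B ≠ ⊤ ∧ ∀ n, ∫⁻ ω, T n ω ^ 2 ∂P ≤ B := by
  set N := ⌈s * 2⌉₊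
  obtain ⟨B, hB, hBn⟩ := exists_lintegral_pow_le hX hindep hlaw (supportEnd p + 1) N
  refine ⟨1 + ENNReal.ofReal (C ^ (N + 1)) * B,
    ENNReal.add_ne_top.2 ⟨ENNReal.one_ne_top, ENNReal.mul_ne_top ENNReal.ofReal_ne_top hB⟩,
    fun n => ?_⟩
  have hpt : ∀ᵐ ω ∂P, T n ω ^ 2 ≤ 1 + ENNReal.ofReal (C ^ (N + 1)) * ENNReal.ofReal
      ((∑ x ∈ Finset.range (supportEnd p + 1), |empiricalFluctuation p X n ω x|) ^ (N + 1)) := by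
    filter_upwards [ae_sample_le hp hκ hlaw] with ω hω
    set Λ := ∑ x ∈ Finset.range (supportEnd p + 1), |empiricalFluctuation p X n ω x| with hΛ
    have hΛ0 : 0 ≤ Λ := Finset.sum_nonneg fun _ _ => abs_nonneg _
    have h0 : 0 ≤ C * Λ := mul_nonneg hC hΛ0
    -- Trades the real exponent `2s` for the integer `N + 1 ≥ 2s`; the summand 1 covers arguments
    -- below 1.
    have h1 : ((C * Λ) ^ s) ^ 2 ≤ 1 + (C * Λ) ^ (N + 1) := by
      rw [← Real.rpow_two, ← Real.rpow_mul h0, ← Real.rpow_natCast]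
      rcases le_total (C * Λ) 1 with h | h
      · have h2 := Real.rpow_le_one h0 h (by positivity : 0 ≤ s * 2)
        have h3 := Real.rpow_nonneg h0 ((N + 1 : ℕ) : ℝ)
        linarith
      · have h2 : (C * Λ) ^ (s * 2) ≤ (C * Λ) ^ ((N + 1 : ℕ) : ℝ) := by
          refine Real.rpow_le_rpow_of_exponent_le h ((Nat.le_ceil _).trans ?_)
          push_cast
          linarith
        linarith
    calc T n ω ^ 2 ≤ ENNReal.ofReal ((C * Λ) ^ s) ^ 2 := by
          gcongr
          exact hT n ω hω
      _ = ENNReal.ofReal (((C * Λ) ^ s) ^ 2) :=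
          (ENNReal.ofReal_pow (Real.rpow_nonneg h0 s) 2).symm
      _ ≤ ENNReal.ofReal (1 + (C * Λ) ^ (N + 1)) := ENNReal.ofReal_le_ofReal h1
      _ = _ := by
          rw [ENNReal.ofReal_add zero_le_one (pow_nonneg h0 _), ENNReal.ofReal_one, mul_pow,
            ENNReal.ofReal_mul (pow_nonneg hC _)]
  refine (lintegral_mono_ae hpt).trans ?_
  rw [lintegral_add_left measurable_const, lintegral_const_mul']
  · simp only [lintegral_const, measure_univ, mul_one]
    gcongr
    exact hBn n
  · exact ENNReal.ofReal_ne_top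

/-- `hgen` settles the terms 0/0 of the Hellinger statistic, hence its limit law; `hne` makes the
mean of the limit infinite when the mixing distribution has a zero in the support. -/
theorem mixingRate_estimator
    (hp : IsDecreasingPMF p) (hκ : BddAbove {x | 0 < p x})
    (hX : ∀ i, Measurable (X i)) (hindep : iIndepFun X P)
    (hlaw : ∀ i x, P.real {ω | X i ω = x} = p x) (hY : IsLimitGaussian p Y P')
    (hφ : IsRegular φ) (hs : Splits φ p)
    (hgen : ∀ᵐ ω ∂P', ∀ x ≤ supportEnd p, mixing p x = 0 →
      mixing (blockwise φ p fun z => Y z ω) x ≠ 0 ∨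
        ∀ᶠ y in 𝓝 (fun z => Y z ω), mixing (blockwise φ p y) x = 0)
    (hne : (∃ x ≤ supportEnd p, mixing p x = 0) → ¬ ∀ᵐ ω ∂P', ∀ x ≤ supportEnd p,
      mixing p x = 0 → mixing (blockwise φ p fun z => Y z ω) x = 0) :
    MixingRate p (estimator φ X) (fun ω => blockwise φ p fun z => Y z ω) P P' := by
  have hclt := tendstoInDistribution_empiricalFluctuation hp hκ hX hindep hlaw hY
  have hΩ : ∀ᵐ ω ∂P, ω ∈ supportedSamples p X := ae_sample_le hp hκ hlaw
  have hY0 := hY.ae_eq_zero_of_lt hp hκ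
  have hcont : Continuous fun y => mixing (blockwise φ p y) :=
    continuous_mixing.comp (continuous_blockwise hp hκ hφ)
  have hlim : AEMeasurable (fun ω => mixing (blockwise φ p fun z => Y z ω)) P' :=
    hcont.measurable.comp_aemeasurable hclt.aemeasurable_limit
  set m := supportEnd p + 1 with hm
  refine ⟨fun k hk => ?_, ?_⟩
  · have hell : TendstoInDistribution (fun n ω => toEll k (mixingFluctuation p (estimator φ X) n ω))
        atTop (fun ω => toEll k (mixing (blockwise φ p fun z => Y z ω))) (fun _ => P) P' := by
      refine tendstoInDistribution_of_nearFilter hclt (fun n => ?_) ?_ hΩ ?_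
      · exact (measurable_comp_estimator hX φ n fun w =>
          toEll k fun x => √(n : ℝ) * (mixing w x - mixing p x)).aemeasurable
      · refine ((continuous_sum_single k m).measurable.comp_aemeasurable hlim).congr ?_
        filter_upwards [hY0] with ω hω
        exact (toEll_eq_sum k (mixing_blockwise_eq_zero hp hκ hω)).symm
      · filter_upwards [hY0] with ω hω
        rw [toEll_eq_sum k (mixing_blockwise_eq_zero hp hκ hω)]
        have h1 := ((continuous_sum_single k m).tendsto _).comp
          (tendsto_mixingFluctuation hp hκ hφ hs X fun z => Y z ω)
        refine h1.congr' ?_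
        filter_upwards [eventually_mem_nearFilter (empiricalFluctuation p X) (supportedSamples p X)
          fun z => Y z ω] with r hr
        exact (toEll_eq_sum k (mixingFluctuation_estimator_eq_zero hp hκ hφ hr)).symm
    obtain ⟨C, hC, hCb⟩ := exists_mixingFluctuation_le hp hκ hφ hs X
    have hnorm : ∀ n : ℕ, ∀ ω ∈ supportedSamples p X,
        ‖toEll k (mixingFluctuation p (estimator φ X) n ω)‖ ≤
          (m * C) * ∑ x ∈ Finset.range m, |empiricalFluctuation p X n ω x| := by
      intro n ω hω
      refine (norm_toEll_le k (mixingFluctuation_estimator_eq_zero hp hκ hφ hω)).trans ?_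
      refine (Finset.sum_le_sum fun x _ => hCb n ω hω x).trans (le_of_eq ?_)
      simp only [Finset.sum_const, Finset.card_range, nsmul_eq_mul]
      ring
    have hmC : 0 ≤ (m : ℝ) * C := by positivity
    refine ⟨⟨fun n => ?_, ?_, hell⟩, ?_, fun hk' => ?_⟩
    · filter_upwards [hΩ] with ω hω
      exact memℓp_of_eq_zero k (mixingFluctuation_estimator_eq_zero hp hκ hφ hω)
    · filter_upwards [hY0] with ω hω
      exact memℓp_of_eq_zero k (mixing_blockwise_eq_zero hp hκ hω)
    · obtain ⟨B, hB, hBn⟩ := exists_lintegral_sq_le hp hκ hX hindep hlaw (s := 1) hmC zero_le_one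
        (T := fun n ω => ENNReal.ofReal ‖toEll k (mixingFluctuation p (estimator φ X) n ω)‖)
        fun n ω hω => ENNReal.ofReal_le_ofReal (by rw [Real.rpow_one]; exact hnorm n ω hω)
      exact convergesInLawAndMean_of_sq_bounded
        (TendstoInDistribution.continuous_comp (g := fun v : Ell k => ‖v‖) continuous_norm hell)
        (fun _ _ => norm_nonneg _) (fun _ => norm_nonneg _) hB hBn
    · obtain ⟨B, hB, hBn⟩ := exists_lintegral_sq_le hp hκ hX hindep hlaw (s := k.toReal) hmC
        ENNReal.toReal_nonneg
        (T := fun n ω =>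
          ENNReal.ofReal (‖toEll k (mixingFluctuation p (estimator φ X) n ω)‖ ^ k.toReal))
        fun n ω hω => ENNReal.ofReal_le_ofReal
          (Real.rpow_le_rpow (norm_nonneg _) (hnorm n ω hω) ENNReal.toReal_nonneg)
      exact convergesInLawAndMean_of_sq_bounded
        (TendstoInDistribution.continuous_comp (g := fun v : Ell k => ‖v‖ ^ k.toReal)
          (continuous_norm.rpow_const fun _ => Or.inr ENNReal.toReal_nonneg) hell)
        (fun _ _ => Real.rpow_nonneg (norm_nonneg _) _)
        (fun _ => Real.rpow_nonneg (norm_nonneg _) _) hB hBn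
  · have hmeas : AEMeasurable (fun ω => weightedSq p (mixing (blockwise φ p fun z => Y z ω))) P' := by
      refine Measurable.comp_aemeasurable (g := weightedSq p) ?_ hlim
      unfold weightedSq
      refine (Finset.measurable_sum _ fun x _ => ?_).const_mul _
      exact ((measurable_pi_apply x).pow_const 2).ennreal_ofReal.div_const _
    have hlaw' : TendstoInDistribution
        (fun (n : ℕ) ω => (n : ℝ≥0∞) * hellingerSq (mixing (estimator φ X n ω)) (mixing p)) atTop
        (fun ω => weightedSq p (mixing (blockwise φ p fun z => Y z ω))) (fun _ => P) P' := by
      refine tendstoInDistribution_of_nearFilter hclt (fun n => ?_) hmeas hΩ ?_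
      · exact (measurable_comp_estimator hX φ n fun w =>
          (n : ℝ≥0∞) * hellingerSq (mixing w) (mixing p)).aemeasurable
      · filter_upwards [hgen] with ω hω
        exact tendsto_hellinger hp hκ hφ hs X hω
    refine ⟨hlaw', ?_⟩
    -- If `q` vanishes somewhere on the support, a finite mean would make the weighted sum almost
    -- surely finite and so every such numerator zero, against `hne`. If not, second moments are
    -- bounded.
    by_cases hq : ∃ x ≤ supportEnd p, mixing p x = 0
    · have htop : ∫⁻ ω, weightedSq p (mixing (blockwise φ p fun z => Y z ω)) ∂P' = ⊤ := by
        by_contra hfin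
        refine hne hq ?_
        filter_upwards [ae_lt_top' hmeas hfin] with ω hω x hx hqx
        by_contra hz
        refine hω.ne ?_
        rw [weightedSq]
        refine ENNReal.mul_eq_top.2 (Or.inl ⟨by simp, ?_⟩)
        refine ENNReal.sum_eq_top.2 ⟨x, Finset.mem_range.2 (Nat.lt_succ_of_le hx), ?_⟩
        rw [hqx, ENNReal.ofReal_zero, ENNReal.div_zero]
        simp only [ne_eq, ENNReal.ofReal_eq_zero, not_le]
        positivity
      have := lintegral_le_liminf_of_tendstoInDistribution hlaw'
      rw [htop] at this ⊢
      exact tendsto_of_le_liminf_of_limsup_le this le_top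
    · push Not at hq
      obtain ⟨C, hC, hCb⟩ := exists_hellinger_le hp hκ hφ hs X hq
      obtain ⟨B, hB, hBn⟩ := exists_lintegral_sq_le hp hκ hX hindep hlaw hC zero_le_two hCb
      exact tendsto_lintegral_of_sq_bounded hlaw' hB hBn

end Rate

/-! ### Ties of the limit process -/

section Ties

variable {Ω' : Type*} [MeasurableSpace Ω'] {P' : Measure Ω'} [IsProbabilityMeasure P']
  {p : ℕ → ℝ} {Y : ℕ → Ω' → ℝ}

/-- For a contrast on a level set the mean term drops out, which leaves a ∑ c_x². -/
theorem covarianceForm_pos {s : Finset ℕ} {c : ℕ → ℝ} {a : ℝ} (ha : 0 < a) (hpa : ∀ x ∈ s, p x = a)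
    (hc : ∑ x ∈ s, c x = 0) {x : ℕ} (hx : x ∈ s) (hcx : c x ≠ 0) : 0 < covarianceForm p s c := by
  rw [covarianceForm_eq, Finset.sum_congr rfl fun z hz => by rw [hpa z hz],
    Finset.sum_congr rfl fun z hz => show c z * p z = c z * a by rw [hpa z hz], ← Finset.sum_mul,
    ← Finset.sum_mul, hc]
  have h1 : 0 < ∑ z ∈ s, c z ^ 2 := Finset.sum_pos' (fun z _ => sq_nonneg _) ⟨x, hx, by positivity⟩
  have := mul_pos h1 ha
  simpa using this

theorem IsLimitGaussian.ae_injOn (hY : IsLimitGaussian p Y P') :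
    ∀ᵐ ω ∂P', ∀ x x', x ≠ x' → 0 < p x → p x' = p x → Y x ω ≠ Y x' ω := by
  refine ae_all_iff.2 fun x => ae_all_iff.2 fun x' => ?_
  by_cases h : x ≠ x' ∧ 0 < p x ∧ p x' = p x
  · obtain ⟨hne, hpos, heq⟩ := h
    have hcov : 0 < covarianceForm p {x, x'} fun z => if z = x then 1 else -1 := by
      refine covarianceForm_pos (x := x) hpos (fun z hz => ?_) ?_ (by simp) (by simp)
      · rcases Finset.mem_insert.1 hz with rfl | hz
        · rfl
        · rw [Finset.mem_singleton.1 hz, heq]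
      · rw [Finset.sum_pair hne]
        simp [hne.symm]
    filter_upwards [hY.ae_sum_ne_zero hcov] with ω hω _ _ _ he
    rw [Finset.sum_pair hne] at hω
    simp [hne.symm, he] at hω
  · exact ae_of_all _ fun ω h1 h2 h3 => absurd ⟨h1, h2, h3⟩ h

/-- The difference of the averages over two adjacent stretches of an interval of constancy is, up to
scale, a nonzero contrast. There are only countably many triples. -/
theorem IsLimitGaussian.ae_averages_ne (hY : IsLimitGaussian p Y P') :
    ∀ᵐ ω ∂P', ∀ a b c, a < b → b < c → 0 < p a → (∀ x ∈ Finset.Ico a c, p x = p a) →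
      ((c : ℝ) - b) * ∑ x ∈ Finset.Ico a b, Y x ω ≠ ((b : ℝ) - a) * ∑ x ∈ Finset.Ico b c, Y x ω := by
  refine ae_all_iff.2 fun a => ae_all_iff.2 fun b => ae_all_iff.2 fun c => ?_
  by_cases h : a < b ∧ b < c ∧ 0 < p a ∧ ∀ x ∈ Finset.Ico a c, p x = p a
  · obtain ⟨hab, hbc, hpos, heq⟩ := h
    have hbc' : (0 : ℝ) < (c : ℝ) - b := sub_pos.2 (by exact_mod_cast hbc)
    set d : ℕ → ℝ := fun x => if x < b then (c : ℝ) - b else -((b : ℝ) - a) with hd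
    have hsum : ∀ y : ℕ → ℝ, ∑ x ∈ Finset.Ico a c, d x * y x =
        ((c : ℝ) - b) * ∑ x ∈ Finset.Ico a b, y x - ((b : ℝ) - a) * ∑ x ∈ Finset.Ico b c, y x := by
      intro y
      rw [← Finset.sum_Ico_consecutive _ hab.le hbc.le, Finset.mul_sum, Finset.mul_sum,
        sub_eq_add_neg, ← Finset.sum_neg_distrib]
      congr 1
      · refine Finset.sum_congr rfl fun x hx => ?_
        simp [hd, (Finset.mem_Ico.1 hx).2]
      · refine Finset.sum_congr rfl fun x hx => ?_
        simp only [hd, (Finset.mem_Ico.1 hx).1.not_gt, if_false]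
        ring
    have hcov : 0 < covarianceForm p (Finset.Ico a c) d := by
      refine covarianceForm_pos (x := a) hpos heq ?_ (Finset.mem_Ico.2 ⟨le_rfl, by omega⟩) ?_
      · have h1 := hsum fun _ => 1
        simp only [mul_one, Finset.sum_const, Nat.card_Ico, nsmul_eq_mul] at h1
        rw [h1, Nat.cast_sub hab.le, Nat.cast_sub hbc.le]
        ring
      · simp only [hd, hab, if_pos]
        exact hbc'.ne'
    filter_upwards [hY.ae_sum_ne_zero hcov] with ω hω _ _ _ _ he
    rw [hsum fun x => Y x ω, sub_ne_zero] at hω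
    exact hω he
  · exact ae_of_all _ fun ω h1 h2 h3 h4 => absurd ⟨h1, h2, h3, h4⟩ h

variable (hp : IsDecreasingPMF p) (hκ : BddAbove {x | 0 < p x})

include hp hκ

/-- Coordinates of a point `x` such that `p_x = p_{x+1}`. -/
theorem exists_block_coordinate {x : ℕ} (hx : x ≤ supportEnd p) (hq : mixing p x = 0) :
    ∃ j, blockStart p x + j = x ∧ j + 1 < blockLength p x := by
  have he : p (x + 1) = p x := mixing_eq_zero_iff.1 hq
  have h1 := blockStart_le hp hκ hx
  have h2 := ((eq_iff_mem_block hp hκ hx _).1 he).2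
  exact ⟨x - blockStart p x, by omega, by omega⟩

theorem mixing_blockwise_eq_zero_iff {x j : ℕ} (hx : x ≤ supportEnd p) (hj : blockStart p x + j = x)
    (hj' : j + 1 < blockLength p x) (φ : ℕ → (ℕ → ℝ) → ℕ → ℝ) (y : ℕ → ℝ) :
    mixing (blockwise φ p y) x = 0 ↔
      φ (blockLength p x) (fun i => y (blockStart p x + i)) (j + 1) =
        φ (blockLength p x) (fun i => y (blockStart p x + i)) j := by
  have h1 := blockwise_blockStart_add hp hκ hx (j := j) (by omega) φ y
  have h2 := blockwise_blockStart_add hp hκ hx hj' φ y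
  rw [hj] at h1
  rw [← add_assoc, hj] at h2
  rw [mixing_eq_zero_iff, h1, h2]

theorem ae_mixing_truncate_ne_zero (hY : IsLimitGaussian p Y P') :
    ∀ᵐ ω ∂P', ∀ x ≤ supportEnd p, mixing p x = 0 →
      mixing (blockwise truncate p fun z => Y z ω) x ≠ 0 := by
  filter_upwards [hY.ae_injOn] with ω hω x hx hq h0
  rw [blockwise_truncate hp hκ, mixing_eq_zero_iff] at h0
  exact hω x (x + 1) (by omega) ((hp.pos_iff_le_supportEnd hκ).2 hx) (mixing_eq_zero_iff.1 hq)
    h0.symm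

/-- Sorting permutes the almost surely distinct values, so consecutive order statistics differ. -/
theorem ae_mixing_rear_ne_zero (hY : IsLimitGaussian p Y P') :
    ∀ᵐ ω ∂P', ∀ x ≤ supportEnd p, mixing p x = 0 →
      mixing (blockwise rear p fun z => Y z ω) x ≠ 0 := by
  filter_upwards [hY.ae_injOn] with ω hω x hx hq h0
  obtain ⟨j, hj, hj'⟩ := exists_block_coordinate hp hκ hx hq
  rw [mixing_blockwise_eq_zero_iff hp hκ hx hj hj'] at h0
  have hj0 : j < blockLength p x := by omega
  simp only [rear, hj', hj0, dif_pos] at h0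
  set σ := Tuple.sort fun i : Fin (blockLength p x) => -Y (blockStart p x + i) ω
  have hpx := (hp.pos_iff_le_supportEnd hκ).2 hx
  have h1 := apply_blockStart_add hp hκ hx (σ ⟨j + 1, hj'⟩).2
  have h2 := apply_blockStart_add hp hκ hx (σ ⟨j, hj0⟩).2
  refine hω _ _ (fun he => ?_) (by rw [h1]; exact hpx) (by rw [h1, h2]) h0
  have h3 : σ ⟨j + 1, hj'⟩ = σ ⟨j, hj0⟩ := Fin.ext (by omega)
  have h4 := σ.injective h3
  simp at h4

/-- If the slopes at `j` and `j + 1` agree, the majorant is almost surely strictly above the partial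
sums between them. That inequality is open in `y`, and by the flat-or-touch alternative it forces
equal slopes nearby. -/
theorem ae_mixing_gren_ne_zero_or (hY : IsLimitGaussian p Y P') :
    ∀ᵐ ω ∂P', ∀ x ≤ supportEnd p, mixing p x = 0 →
      mixing (blockwise gren p fun z => Y z ω) x ≠ 0 ∨
        ∀ᶠ y in 𝓝 (fun z => Y z ω), mixing (blockwise gren p y) x = 0 := by
  filter_upwards [hY.ae_averages_ne] with ω hω x hx hq
  obtain ⟨j, hj, hj'⟩ := exists_block_coordinate hp hκ hx hq
  simp only [ne_eq, mixing_blockwise_eq_zero_iff hp hκ hx hj hj']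
  refine or_iff_not_imp_left.2 fun hflat => ?_
  rw [not_not] at hflat
  set r := blockStart p x
  set L := blockLength p x
  have hG : ∀ y : ℕ → ℝ, IsGren L (fun i => y (r + i)) (gren L fun i => y (r + i)) :=
    fun y => isGren_gren _ _
  have hstrict : ∑ i ∈ Finset.range (j + 1), Y (r + i) ω ≠
      ∑ i ∈ Finset.range (j + 1), gren L (fun i => Y (r + i) ω) i := by
    intro ht
    -- Touching in the middle of a flat stretch would give the stretches from `a` to `j + 1` and
    -- from `j + 1` to `b` the same average, which `ae_averages_ne` excludes.
    obtain ⟨a, ha, hta, hca⟩ := (hG fun z => Y z ω).exists_touch_left (show j < L by omega)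
    obtain ⟨b, hb, hbL, htb, hcb⟩ := (hG fun z => Y z ω).exists_touch_right hj'
    set g := gren L (fun i => Y (r + i) ω) j
    have e1 : ∑ i ∈ Finset.Ico a (j + 1), Y (r + i) ω = ((j + 1 : ℕ) - (a : ℝ)) * g := by
      rw [Finset.sum_Ico_eq_sub _ (by omega), ht, ← hta, ← Finset.sum_Ico_eq_sub _ (by omega),
        Finset.sum_congr rfl fun i hi => hca i (Finset.mem_Ico.1 hi).1
          (Nat.lt_succ_iff.1 (Finset.mem_Ico.1 hi).2),
        Finset.sum_const, Nat.card_Ico, nsmul_eq_mul, Nat.cast_sub (by omega)]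
    have e2 : ∑ i ∈ Finset.Ico (j + 1) b, Y (r + i) ω = ((b : ℝ) - (j + 1 : ℕ)) * g := by
      rw [Finset.sum_Ico_eq_sub _ (by omega), ht, ← htb, ← Finset.sum_Ico_eq_sub _ (by omega),
        Finset.sum_congr rfl fun i hi => (hcb i (Finset.mem_Ico.1 hi).1
          (Finset.mem_Ico.1 hi).2).trans hflat,
        Finset.sum_const, Nat.card_Ico, nsmul_eq_mul, Nat.cast_sub (by omega)]
    have hpx := (hp.pos_iff_le_supportEnd hκ).2 hx
    have hra : p (r + a) = p x := apply_blockStart_add hp hκ hx (show a < L by omega)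
    refine hω (r + a) (r + (j + 1)) (r + b) (by omega) (by omega) (by rw [hra]; exact hpx) ?_ ?_
    · intro z hz
      rw [Finset.mem_Ico] at hz
      rw [hra]
      exact (eq_iff_mem_block hp hκ hx z).2 ⟨by omega, by omega⟩
    · rw [Nat.add_comm r a, Nat.add_comm r (j + 1), Nat.add_comm r b,
        ← Finset.sum_Ico_add (fun z => Y z ω), ← Finset.sum_Ico_add (fun z => Y z ω), e1, e2]
      push_cast
      ring
  have hlt : ∑ i ∈ Finset.range (j + 1), Y (r + i) ω <
      ∑ i ∈ Finset.range (j + 1), gren L (fun i => Y (r + i) ω) i :=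
    lt_of_le_of_ne ((hG fun z => Y z ω).sum_le _ hj'.le) hstrict
  have hc1 : Continuous fun y : ℕ → ℝ => ∑ i ∈ Finset.range (j + 1), y (r + i) := by fun_prop
  have hc2 : Continuous fun y : ℕ → ℝ =>
      ∑ i ∈ Finset.range (j + 1), gren L (fun i => y (r + i)) i := by
    refine continuous_finsetSum _ fun i hi => ?_
    have hi' : i < L := by have := Finset.mem_range.1 hi; omega
    have h1 := (continuous_apply (r + i)).comp (continuous_blockwise hp hκ isRegular_gren)
    refine h1.congr fun y => ?_
    exact blockwise_blockStart_add hp hκ hx hi' gren y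
  filter_upwards [(hc1.tendsto _).eventually_lt (hc2.tendsto _) hlt] with y hy
  exact (((hG y).flat_or_touch j hj').resolve_right hy.ne').symm

/-- Slopes constant over a whole interval of constancy equal its average, so the first value is at
most the average. If this held almost surely, a centred nondegenerate Gaussian contrast would be
nonpositive, hence zero, almost surely. -/
theorem not_ae_mixing_gren_eq_zero (hY : IsLimitGaussian p Y P')
    (hex : ∃ x ≤ supportEnd p, mixing p x = 0) :
    ¬ ∀ᵐ ω ∂P', ∀ x ≤ supportEnd p, mixing p x = 0 →
      mixing (blockwise gren p fun z => Y z ω) x = 0 := by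
  intro hall
  obtain ⟨x, hx, hq⟩ := hex
  obtain ⟨j, hj, hj'⟩ := exists_block_coordinate hp hκ hx hq
  have hpx := (hp.pos_iff_le_supportEnd hκ).2 hx
  have hend := blockStart_add_le hp hκ hx
  have hblock := fun z => eq_iff_mem_block hp hκ hx z
  set r := blockStart p x with hr
  set L := blockLength p x with hL
  set d : ℕ → ℝ := fun z => (if z = r then (L : ℝ) else 0) - 1 with hd
  have hsum : ∀ y : ℕ → ℝ, ∑ z ∈ Finset.Ico r (r + L), d z * y z =
      L * y r - ∑ i ∈ Finset.range L, y (r + i) := by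
    intro y
    have h1 : r ∈ Finset.Ico r (r + L) := Finset.mem_Ico.2 ⟨le_rfl, by omega⟩
    simp only [hd, sub_mul, one_mul, Finset.sum_sub_distrib, ite_mul, zero_mul,
      Finset.sum_ite_eq', h1, if_pos]
    rw [Finset.sum_Ico_eq_sum_range, Nat.add_sub_cancel_left]
  have hcov : 0 < covarianceForm p (Finset.Ico r (r + L)) d := by
    refine covarianceForm_pos (x := r + 1) hpx (fun z hz => (hblock z).2 (Finset.mem_Ico.1 hz)) ?_
      (Finset.mem_Ico.2 ⟨by omega, by omega⟩) (by simp [hd])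
    have h1 := hsum fun _ => 1
    simpa using h1
  have hle : ∀ᵐ ω ∂P', ∑ z ∈ Finset.Ico r (r + L), d z * Y z ω ≤ 0 := by
    filter_upwards [hall] with ω hω
    rw [hsum fun z => Y z ω]
    have hG := isGren_gren L fun i => Y (r + i) ω
    have hconst : ∀ i < L, gren L (fun i => Y (r + i) ω) i = gren L (fun i => Y (r + i) ω) 0 := by
      intro i
      induction i with
      | zero => exact fun _ => rfl
      | succ k ih =>
        intro hk
        rw [← ih (by omega)]
        have hk1 : p (r + k) = p x := (hblock _).2 ⟨by omega, by omega⟩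
        have hk2 : p (r + k + 1) = p x := (hblock _).2 ⟨by omega, by omega⟩
        have h0 := mixing_eq_zero_iff.1
          (hω (r + k) (by omega) (mixing_eq_zero_iff.2 (hk2.trans hk1.symm)))
        rwa [add_assoc, blockwise_blockStart_add hp hκ hx hk,
          blockwise_blockStart_add hp hκ hx (by omega)] at h0
    have h1 := hG.sum_eq
    rw [Finset.sum_congr rfl fun i hi => hconst i (Finset.mem_range.1 hi)] at h1
    have h2 := hG.sum_le 1 (by omega)
    simp only [Finset.sum_const, Finset.card_range, nsmul_eq_mul, Finset.sum_range_one,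
      add_zero] at h1 h2
    rw [← h1]
    have h3 : (0 : ℝ) ≤ L := Nat.cast_nonneg _
    linarith [mul_le_mul_of_nonneg_left h2 h3]
  have hint : Integrable (fun ω => ∑ z ∈ Finset.Ico r (r + L), d z * Y z ω) P' :=
    integrable_finsetSum _ fun z _ => ((hY.memLp_two z).integrable (by norm_num)).const_mul _
  have hmean : ∫ ω, ∑ z ∈ Finset.Ico r (r + L), d z * Y z ω ∂P' = 0 := by
    rw [integral_finsetSum _ fun z _ => ((hY.memLp_two z).integrable (by norm_num)).const_mul _]
    simp [integral_const_mul, hY.mean]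
  have hzero : ∀ᵐ ω ∂P', -∑ z ∈ Finset.Ico r (r + L), d z * Y z ω = 0 := by
    refine (integral_eq_zero_iff_of_nonneg_ae ?_ hint.neg).1 ?_
    · filter_upwards [hle] with ω hω
      simpa using hω
    · simp only [Pi.neg_apply, integral_neg, hmean, neg_zero]
  obtain ⟨ω, h1, h2⟩ := (hzero.and (hY.ae_sum_ne_zero hcov)).exists
  exact h2 (neg_eq_zero.1 h1)

end Ties

end DiscreteMonotone

/-! ### Assembly for the three estimators -/

theorem mainTheorem11
    {Ω Ω' : Type*} [MeasurableSpace Ω] [MeasurableSpace Ω']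
    (P : Measure Ω) [IsProbabilityMeasure P] (P' : Measure Ω') [IsProbabilityMeasure P']
    (p : ℕ → ℝ) (hp : DiscreteMonotone.IsDecreasingPMF p) (hκ : BddAbove {x | 0 < p x})
    (X : ℕ → Ω → ℕ) (hX : ∀ i, Measurable (X i)) (hindep : iIndepFun X P)
    (hlaw : ∀ i x, P.real {ω | X i ω = x} = p x)
    (Y : ℕ → Ω' → ℝ) (hY : DiscreteMonotone.IsLimitGaussian p Y P') :
    DiscreteMonotone.MixingRate p (DiscreteMonotone.empirical X) (fun ω x => Y x ω) P P' ∧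
    DiscreteMonotone.MixingRate p (DiscreteMonotone.rearEstimator X)
      (DiscreteMonotone.limitRear p Y) P P' ∧
    DiscreteMonotone.MixingRate p (DiscreteMonotone.grenEstimator X)
      (DiscreteMonotone.limitGren p Y) P P' := by
  open DiscreteMonotone in
  have htrunc := ae_mixing_truncate_ne_zero hp hκ hY
  have hrear := ae_mixing_rear_ne_zero hp hκ hY
  refine ⟨?_, ?_, ?_⟩
  · have h := mixingRate_estimator hp hκ hX hindep hlaw hY isRegular_truncate
      (splits_truncate hp hκ)
      -- The limit is almost surely nonzero wherever `q` vanishes on the support. This gives the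
      -- first alternative of `hgen` and contradicts almost sure vanishing in `hne`.
      (htrunc.mono fun ω hω x hx hq => Or.inl (hω x hx hq)) fun ⟨x, hx, hq⟩ hall => by
        obtain ⟨ω, h1, h2⟩ := (hall.and htrunc).exists
        exact h2 x hx hq (h1 x hx hq)
    simpa only [estimator_truncate, blockwise_truncate hp hκ] using h
  · exact mixingRate_estimator hp hκ hX hindep hlaw hY isRegular_rear (splits_rear hp hκ)
      (hrear.mono fun ω hω x hx hq => Or.inl (hω x hx hq)) fun ⟨x, hx, hq⟩ hall => by
        obtain ⟨ω, h1, h2⟩ := (hall.and hrear).exists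
        exact h2 x hx hq (h1 x hx hq)
  · exact mixingRate_estimator hp hκ hX hindep hlaw hY isRegular_gren (splits_gren hp hκ)
      (ae_mixing_gren_ne_zero_or hp hκ hY) (not_ae_mixing_gren_eq_zero hp hκ hY)
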